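/- Fix $c>1$, $\rho_q\ge 0$ and $0\le\rho_s\le 1$ with $$(2c^2-1)\,\rho_q+2c^2(c^2-1)\sqrt{\rho_s(1-\rho_s)}\;\ge\;c^4 .$$ Put $r=\sqrt2/c$ and $\gamma^*=1-1/c^2$ (two unit vectors are at distance at most $r$ iff their dot product is at least $\gamma^*$). Let $n=n(d)$ satisfy $n=2^{o(d)}$ and $d=n^{o(1)}$ as $d\to\infty$. For $\alpha\in(0,1)$, the $\alpha$-near neighbor graph of a data set of $n$ points on the unit sphere $S^{d-1}\subset\mathbb R^d$ joins two distinct points iff their dot product is at least $\alpha$; the data structure stores the points and the list of neighbors of each point. Its space counts one unit per coordinate of each point and $\lfloor\log_2 n\rfloor+1$ units per list entry. A query $q\in S^{d-1}$ is answered by a greedy walk with restarts. Start at a uniformly random data point $p$. While $\langle p,q\rangle<\gamma^*$, go once through the list of neighbors $p'$ of $p$, replacing the current point by $p'$ whenever $\langle p',q\rangle$ exceeds the dot product of the current point with $q$ by at least $1/d$; if no replacement occurs, restart at a fresh, independent, uniformly random data point. When the loop ends, return the current point. Time counts elementary operations (arithmetic on real numbers, comparisons, memory accesses, random draws of a data point),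 with $2d$ operations per dot product. Then there are $\alpha_d\in(0,1)$ such that, for all $\varepsilon,\delta>0$ and all sufficiently large $d$, the following holds for all $q,p^*\in S^{d-1}$ with $\|p^*-q\|\le r$. Take a data set of $n$ points that contains $p^*$ at an arbitrary position and whose other $n-1$ points are independent and uniformly distributed on $S^{d-1}$. With probability at least $1-\delta$ over the data set and the random choices of the algorithm, the $\alpha_d$-near neighbor graph uses space at most $n^{1+\rho_s+\varepsilon}$, and the query $q$ ends within time $n^{\rho_q+\varepsilon}$ and returns the planted near neighbor $p^*$. In other words, this is a graph-based $(c,r)$-ANN data structure with space $n^{1+\rho_s+o(1)}$ and query time $n^{\rho_q+o(1)}$. -/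

import Mathlib

open MeasureTheory ProbabilityTheory Filter Topology Asymptotics

noncomputable section

/-- The Euclidean unit sphere in `ℝ^d`; its distance is the Euclidean distance of `ℝ^d`. -/
abbrev UnitSphere (d : ℕ) : Type :=
  Metric.sphere (0 : EuclideanSpace ℝ (Fin d)) 1

/-- Standard dot product of two points of the sphere. -/
def ip {d : ℕ} (u v : UnitSphere d) : ℝ :=
  inner ℝ (u : EuclideanSpace ℝ (Fin d)) (v : EuclideanSpace ℝ (Fin d))

/-- The uniform distribution on the sphere: normalized surface measure (for `1 ≤ d`). -/
def uniformSphere (d : ℕ) : Measure (UnitSphere d) :=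
  ((volume : Measure (EuclideanSpace ℝ (Fin d))).toSphere Set.univ)⁻¹ •
    (volume : Measure (EuclideanSpace ℝ (Fin d))).toSphere

/-- The law of a random data set of `n` points with the point `pstar` planted at position `i`:
all other points are independent and uniform on the sphere. -/
def dataLaw (d n : ℕ) (i : Fin n) (pstar : UnitSphere d) : Measure (Fin n → UnitSphere d) :=
  Measure.pi (fun j => if j = i then Measure.dirac pstar else uniformSphere d)

/-- The law of the coin tosses of the query algorithm: an infinite sequence of independent,
uniformly random vertices, read one at a time whenever a (new) starting point is needed. -/
def coinLaw (n : ℕ) : Measure (ℕ → Fin n) :=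
  Measure.infinitePi (fun _ => uniformOn (Set.univ : Set (Fin n)))

/-- The `α`-near neighbor graph of the data set `x`: distinct points are joined if and only if
their dot product is at least `α`. -/
def nnGraph {d n : ℕ} (α : ℝ) (x : Fin n → UnitSphere d) : SimpleGraph (Fin n) where
  Adj i j := i ≠ j ∧ α ≤ ip (x i) (x j)
  symm := ⟨fun i j h => ⟨h.1.symm, by
    have h2 := h.2
    unfold ip at h2 ⊢
    rwa [real_inner_comm]⟩⟩
  loopless := ⟨fun _ h => h.1 rfl⟩

open Classical in
/-- The bucket of a vertex: the stored list of its neighbors in the graph. -/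
def bucket {d n : ℕ} (α : ℝ) (x : Fin n → UnitSphere d) (v : Fin n) : List (Fin n) :=
  (List.finRange n).filter (fun w => (nnGraph α x).Adj v w)

/-- Space of the data structure: one unit for each coordinate of each data point, and
`⌊log₂ n⌋ + 1` units (bits of an index) for each entry of each bucket. -/
def space {d n : ℕ} (α : ℝ) (x : Fin n → UnitSphere d) : ℕ :=
  n * d + ∑ v : Fin n, (bucket α x v).length * (Nat.log 2 n + 1)

/-- State inside the loop over a bucket: current vertex, progress flag, elapsed time. -/
structure ScanState (n : ℕ) where
  cur : Fin n
  progress : Bool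
  time : ℕ

open Classical in
/-- One round of the loop over a bucket: move to the neighbor `w` if its dot product with the query
exceeds that of the current vertex by at least `1 / d`. Cost: `2 d` for the dot product of `w` with
the query, and `5` for reading `w`, adding `1 / d`, comparing, and the two assignments. -/
def scanStep {d n : ℕ} (x : Fin n → UnitSphere d) (q : UnitSphere d)
    (s : ScanState n) (w : Fin n) : ScanState n :=
  if ip (x s.cur) q + 1 / (d : ℝ) ≤ ip (x w) q then ⟨w, true, s.time + (2 * d + 5)⟩
  else ⟨s.cur, s.progress, s.time + (2 * d + 5)⟩

/-- State at the head of the main loop: current vertex, number of starting points drawn so far,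
elapsed time. -/
structure QueryState (n : ℕ) where
  cur : Fin n
  draws : ℕ
  time : ℕ

/-- One execution of the main loop, for a current vertex that failed the exit test. The exit test
costs `2 d + 1` (dot product, comparison); then the progress flag is reset, the whole bucket of the
current vertex is scanned, and, if no progress was made, a new starting point is drawn; these
bookkeeping operations cost `3`. -/
def queryStep {d n : ℕ} (α : ℝ) (x : Fin n → UnitSphere d) (q : UnitSphere d) (ω : ℕ → Fin n)
    (s : QueryState n) : QueryState n :=
  let r := (bucket α x s.cur).foldl (scanStep x q) ⟨s.cur, false, s.time + (2 * d + 1) + 3⟩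
  if r.progress then ⟨r.cur, s.draws, r.time⟩ else ⟨ω s.draws, s.draws + 1, r.time⟩

/-- State at the head of the main loop after `k` executions of its body; the first starting point
is `ω 0`, drawn at cost `1`. -/
def queryState {d n : ℕ} (α : ℝ) (x : Fin n → UnitSphere d) (q : UnitSphere d) (ω : ℕ → Fin n)
    (k : ℕ) : QueryState n :=
  (queryStep α x q ω)^[k] ⟨ω 0, 1, 1⟩

/-- On the data set `x`, query `q` and coin tosses `ω`, the greedy walk with restarts halts, returns
the vertex `v`, and has then used exactly `T` elementary operations. It halts as soon as the current
vertex has dot product at least `γ` with the query. -/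
def QueryReturns {d n : ℕ} (α γ : ℝ) (x : Fin n → UnitSphere d) (q : UnitSphere d)
    (ω : ℕ → Fin n) (v : Fin n) (T : ℕ) : Prop :=
  ∃ k : ℕ,
    (∀ j < k, ip (x (queryState α x q ω j).cur) q < γ) ∧
    γ ≤ ip (x (queryState α x q ω k).cur) q ∧
    (queryState α x q ω k).cur = v ∧
    (queryState α x q ω k).time + (2 * d + 1) = T

end

/-! ### Volumes of cones and caps -/

/-! Write `ℓ = log n` and `s = √(2ℓ/d)`. At this scale dot products behave like Gaussians: a uniform
point has dot product at least `a s` with a fixed point with probability `n^(-a² + o(1))`. It passes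
thresholds `a s` against `p` and `b s` against `q` with probability at least `n^(-m - o(1))`, where
`m` is the squared norm of a vector `u` with `⟨u, p⟩ ≥ a` and `⟨u, q⟩ ≥ b`. When `p` and `q` are
nearly orthogonal, `a² + b²` is also the right exponent for an upper bound.

Suppose `ρq < 1`. Take `σ = min ρs (1/2)`, `a² = 1 - σ`, `b² = σ` and `α = a s`, so that buckets
have about `n^σ` points. Call a point high if its dot product with `q` is at least `(b + η/2) s`. A
point is near a given vertex that is almost orthogonal to `q`, and also high, with probability
`n^(-1-ξ)`, so such a vertex typically has no high neighbor. A target is a point that is a neighbor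
of `pstar` and has dot product at least `(b + η) s` with `q`; points are targets with probability
about `n^(-E)`, `E = (1 - 2γab)/(1 - γ²)`. There are about `n^(1-E+σ)` edges into targets. By a
first-moment bound, fewer than half of them have a high starting vertex or one with a second high
neighbor. From the remaining starting vertices the scan must end at the target (or directly at
`pstar`), in whatever order the bucket is read, and the next scan must end at `pstar`, since every
other point is far from `q`. Hence a fraction `n^(σ-E)` of all starting points is good, and
`n^(E-σ+o(1))` draws suffice. Moves gain `1/d` in a quantity bounded by `1`, so each draw is
followed by `O(d)` iterations of cost `n^(σ+o(1))`, which gives time `n^(E+o(1))`. The trade-off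
hypothesis says `E ≤ ρq`. If `ρq ≥ 1`, drawing `pstar` itself among `n^(1+o(1))` samples is enough.

The geometry is in `uniformSphere_cap_le`, `uniformSphere_two_caps_le`,
`SparseRegime.eventually_quadrant_ge` and `exists_short_vector`; the random graph in
`exists_rare_set_relay`, where dependence between points is handled by resampling one coordinate at
a time; the walk in `queryReturns_of_goodStart`; the two regimes in `achieves_sampling` and
`achieves_greedy`. -/

open scoped Pointwise ENNReal in
-- `toSphere` measures a set through the volume of the truncated cone over it, so probabilities on
-- the sphere become volume ratios in the ball. The missing apex is a null set because `1 ≤ d`.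
theorem uniformSphere_cone {d : ℕ} (hd : 1 ≤ d) (S : Set (EuclideanSpace ℝ (Fin d)))
    (hS : MeasurableSet S) (hcone : ∀ r : ℝ, 0 < r → ∀ x ∈ S, r • x ∈ S) :
    uniformSphere d {u | (u : EuclideanSpace ℝ (Fin d)) ∈ S} =
      (volume (Metric.ball (0 : EuclideanSpace ℝ (Fin d)) 1))⁻¹ * volume (S ∩ Metric.ball 0 1) := by
  have hd0 : (d : ℝ≥0∞) ≠ 0 := by simp; omega
  have hmeas : MeasurableSet {u : UnitSphere d | (u : EuclideanSpace ℝ (Fin d)) ∈ S} :=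
    measurable_subtype_coe hS
  have hset : Set.Ioo (0 : ℝ) 1 • ((↑) '' {u : UnitSphere d | (u : EuclideanSpace ℝ (Fin d)) ∈ S})
      = (S ∩ Metric.ball 0 1) \ {(0 : EuclideanSpace ℝ (Fin d))} := by
    ext x
    simp only [Set.mem_smul, Set.mem_image, Set.mem_ofPred_eq, Set.mem_sdiff, Set.mem_inter_iff,
      Metric.mem_ball, dist_zero_right, Set.mem_singleton_iff, Set.mem_Ioo]
    constructor
    · rintro ⟨r, ⟨hr0, hr1⟩, _, ⟨u, hu, rfl⟩, rfl⟩
      have hun : ‖(u : EuclideanSpace ℝ (Fin d))‖ = 1 := by simp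
      refine ⟨⟨hcone r hr0 _ hu, ?_⟩, ?_⟩
      · rw [norm_smul, hun, Real.norm_of_nonneg hr0.le]; linarith
      · intro h
        have := congrArg norm h
        rw [norm_smul, hun, Real.norm_of_nonneg hr0.le] at this
        simp at this; linarith
    · rintro ⟨⟨hxS, hx1⟩, hx0⟩
      have hn : 0 < ‖x‖ := norm_pos_iff.2 hx0
      refine ⟨‖x‖, ⟨hn, hx1⟩, ‖x‖⁻¹ • x, ⟨⟨‖x‖⁻¹ • x, ?_⟩, hcone _ (inv_pos.2 hn) _ hxS, rfl⟩, ?_⟩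
      · simp [norm_smul, hn.ne']
      · rw [smul_smul, mul_inv_cancel₀ hn.ne', one_smul]
  have : Nonempty (Fin d) := ⟨⟨0, hd⟩⟩
  rw [uniformSphere, Measure.smul_apply, Measure.toSphere_apply' _ hmeas, hset,
    Measure.toSphere_apply_univ, measure_sdiff_null (measure_singleton _), smul_eq_mul,
    finrank_euclideanSpace_fin,
    ENNReal.mul_inv (Or.inl hd0) (Or.inl (ENNReal.natCast_ne_top d)), mul_mul_mul_comm,
    ENNReal.inv_mul_cancel hd0 (ENNReal.natCast_ne_top d), one_mul]

theorem isProbabilityMeasure_uniformSphere {d : ℕ} (hd : 1 ≤ d) :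
    IsProbabilityMeasure (uniformSphere d) := by
  constructor
  have h := uniformSphere_cone hd Set.univ .univ (fun _ _ _ _ => trivial)
  simp only [Set.mem_univ, Set.ofPred_true, Set.univ_inter] at h
  rw [h, ENNReal.inv_mul_cancel (Metric.measure_ball_pos _ _ one_pos).ne' measure_ball_lt_top.ne]

/-- The truncated cone fits in a ball centered at `t • y`: the squared distance is at most `r² -
2t²r + t²` with `r = ‖x‖ ≤ 1`, which by convexity is at most `max (t²) (1 - t²)`. For `t² ≤ 1/2`
this is `1 - t² ≤ exp (-t²)`. -/
theorem volume_cone_inter_ball_le {d : ℕ} (y : EuclideanSpace ℝ (Fin d)) (hy : ‖y‖ = 1) (t : ℝ)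
    (ht : 0 ≤ t) (ht2 : t ^ 2 ≤ 1 / 2) :
    volume ({x : EuclideanSpace ℝ (Fin d) | t * ‖x‖ ≤ inner ℝ x y} ∩ Metric.ball 0 1) ≤
      ENNReal.ofReal (Real.exp (-(d * t ^ 2 / 2))) *
        volume (Metric.ball (0 : EuclideanSpace ℝ (Fin d)) 1) := by
  have hsub : {x : EuclideanSpace ℝ (Fin d) | t * ‖x‖ ≤ inner ℝ x y} ∩ Metric.ball 0 1 ⊆
      Metric.closedBall (t • y) (Real.exp (-(t ^ 2 / 2))) := by
    rintro x ⟨hx, hx1⟩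
    simp only [Set.mem_ofPred_eq, Metric.mem_ball, dist_zero_right] at hx hx1
    rw [Metric.mem_closedBall, dist_eq_norm]
    refine abs_le_of_sq_le_sq' ?_ (Real.exp_pos _).le |>.2
    have h1 : ‖x - t • y‖ ^ 2 = ‖x‖ ^ 2 - 2 * t * inner ℝ x y + t ^ 2 := by
      rw [norm_sub_sq_real, inner_smul_right, norm_smul, hy, mul_one, Real.norm_eq_abs, sq_abs]
      ring
    have h2 : Real.exp (-(t ^ 2 / 2)) ^ 2 = Real.exp (-t ^ 2) := by
      rw [← Real.exp_nat_mul]; congr 1; push_cast; ring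
    rw [h1, h2]
    have h3 := Real.add_one_le_exp (-t ^ 2)
    nlinarith [norm_nonneg x, mul_le_mul_of_nonneg_left hx ht,
      mul_nonneg (norm_nonneg x) (sub_nonneg.2 hx1.le)]
  refine (measure_mono hsub).trans ?_
  rw [Measure.addHaar_closedBall _ _ (Real.exp_pos _).le, finrank_euclideanSpace_fin,
    ← Real.exp_nat_mul]
  refine le_of_eq ?_
  congr 3
  ring

theorem measurableSet_cap_cone {d : ℕ} (y : EuclideanSpace ℝ (Fin d)) (t : ℝ) :
    MeasurableSet {x : EuclideanSpace ℝ (Fin d) | t * ‖x‖ ≤ inner ℝ x y} :=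
  (isClosed_le (by fun_prop) (by fun_prop)).measurableSet

theorem uniformSphere_cap_le {d : ℕ} (hd : 1 ≤ d) (y : EuclideanSpace ℝ (Fin d)) (hy : ‖y‖ = 1)
    (t : ℝ) (ht : 0 ≤ t) (ht2 : t ^ 2 ≤ 1 / 2) :
    uniformSphere d {u | t ≤ inner ℝ (u : EuclideanSpace ℝ (Fin d)) y} ≤
      ENNReal.ofReal (Real.exp (-(d * t ^ 2 / 2))) := by
  have h := uniformSphere_cone hd _ (measurableSet_cap_cone y t) (by
    intro r hr x hx
    simp only [Set.mem_ofPred_eq] at hx ⊢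
    rw [norm_smul, inner_smul_left, Real.norm_of_nonneg hr.le]
    simp only [conj_trivial]
    nlinarith)
  have hset : {u : UnitSphere d | t ≤ inner ℝ (u : EuclideanSpace ℝ (Fin d)) y} =
      {u : UnitSphere d | (u : EuclideanSpace ℝ (Fin d)) ∈
        {x : EuclideanSpace ℝ (Fin d) | t * ‖x‖ ≤ inner ℝ x y}} := by
    ext u; simp
  rw [hset, h]
  calc _ ≤ (volume (Metric.ball (0 : EuclideanSpace ℝ (Fin d)) 1))⁻¹ *
        (ENNReal.ofReal (Real.exp (-(d * t ^ 2 / 2))) *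
        volume (Metric.ball (0 : EuclideanSpace ℝ (Fin d)) 1)) := by
        gcongr; exact volume_cone_inter_ball_le y hy t ht ht2
    _ = _ := by
      rw [mul_left_comm, ENNReal.inv_mul_cancel (Metric.measure_ball_pos _ _ one_pos).ne'
        measure_ball_lt_top.ne, mul_one]

theorem inner_reflection_orthogonal {F : Type*} [NormedAddCommGroup F] [InnerProductSpace ℝ F]
    (p x y : F) (hp : ‖p‖ = 1) :
    inner ℝ ((ℝ ∙ p)ᗮ.reflection x) y = inner ℝ x y - 2 * inner ℝ x p * inner ℝ p y := by
  rw [Submodule.reflection_orthogonal_apply, Submodule.reflection_singleton_apply, inner_neg_left,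
    inner_sub_left, two_smul, inner_add_left, inner_smul_left, hp, real_inner_comm p x]
  simp
  ring

open scoped ENNReal in
-- Four isometric copies of the quadrant cover the ball. The identity and `-1` handle equal signs;
-- for mixed signs, reflecting along the vector with the negative product repairs that sign and, as
-- `⟨p, q⟩ ≥ 0`, only increases the other product.
theorem volume_ball_le_four_mul_quadrant {d : ℕ} (p q : EuclideanSpace ℝ (Fin d)) (hp : ‖p‖ = 1)
    (hq : ‖q‖ = 1) (hpq : 0 ≤ inner ℝ p q) :
    volume (Metric.ball (0 : EuclideanSpace ℝ (Fin d)) 1) ≤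
      4 * volume {y : EuclideanSpace ℝ (Fin d) | ‖y‖ < 1 ∧ 0 ≤ inner ℝ y p ∧ 0 ≤ inner ℝ y q} := by
  set A := {y : EuclideanSpace ℝ (Fin d) | ‖y‖ < 1 ∧ 0 ≤ inner ℝ y p ∧ 0 ≤ inner ℝ y q} with hA
  have key : ∀ e : EuclideanSpace ℝ (Fin d) ≃ₗᵢ[ℝ] EuclideanSpace ℝ (Fin d),
      volume (e ⁻¹' A) = volume A := fun e =>
    e.measurePreserving.measure_preimage_emb e.toHomeomorph.measurableEmbedding A
  have hcover : Metric.ball (0 : EuclideanSpace ℝ (Fin d)) 1 ⊆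
      (A ∪ (LinearIsometryEquiv.neg ℝ) ⁻¹' A) ∪
      (((ℝ ∙ p)ᗮ.reflection) ⁻¹' A ∪ ((ℝ ∙ q)ᗮ.reflection) ⁻¹' A) := by
    intro y hy
    have hy1 : ‖y‖ < 1 := by simpa using hy
    simp only [hA, Set.mem_union, Set.mem_preimage, Set.mem_ofPred_eq,
      LinearIsometryEquiv.norm_map, hy1, true_and, LinearIsometryEquiv.coe_neg, inner_neg_left,
      inner_reflection_orthogonal _ _ _ hp, inner_reflection_orthogonal _ _ _ hq,
      real_inner_self_eq_norm_sq, hp, hq, real_inner_comm p q, norm_neg]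
    rcases le_total 0 (inner ℝ y p) with h1 | h1 <;> rcases le_total 0 (inner ℝ y q) with h2 | h2
    · exact Or.inl (Or.inl ⟨h1, h2⟩)
    · refine Or.inr (Or.inr ⟨?_, ?_⟩) <;> nlinarith
    · refine Or.inr (Or.inl ⟨?_, ?_⟩) <;> nlinarith
    · refine Or.inl (Or.inr ⟨?_, ?_⟩) <;> linarith
  calc _ ≤ _ := measure_mono hcover
    _ ≤ (volume A + volume ((LinearIsometryEquiv.neg ℝ) ⁻¹' A)) +
      (volume (((ℝ ∙ p)ᗮ.reflection) ⁻¹' A) + volume (((ℝ ∙ q)ᗮ.reflection) ⁻¹' A)) :=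
      (measure_union_le _ _).trans (add_le_add (measure_union_le _ _) (measure_union_le _ _))
    _ = 4 * volume A := by rw [key, key, key]; ring

open scoped Pointwise in
/-- Volume of a shifted quadrant inside the unit ball. -/
theorem volume_shifted_quadrant_ge {d : ℕ} (hd : 18 ≤ d) (p q u : EuclideanSpace ℝ (Fin d))
    (hp : ‖p‖ = 1) (hq : ‖q‖ = 1) (hpq : 0 ≤ inner ℝ p q) (R : ℝ) (hR : 0 < R)
    (hRu : R ^ 2 + ‖u‖ ^ 2 + 6 * ‖u‖ / Real.sqrt d ≤ 1) :
    ENNReal.ofReal (R ^ d / 8) * volume (Metric.ball (0 : EuclideanSpace ℝ (Fin d)) 1) ≤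
      volume {x : EuclideanSpace ℝ (Fin d) |
        ‖x‖ < 1 ∧ inner ℝ u p ≤ inner ℝ x p ∧ inner ℝ u q ≤ inner ℝ x q} := by
  have hd0 : (0 : ℝ) < d := by exact_mod_cast (by omega : 0 < d)
  have hsd : 0 < Real.sqrt d := Real.sqrt_pos.2 hd0
  set V := volume (Metric.ball (0 : EuclideanSpace ℝ (Fin d)) 1) with hV
  set κ := 3 * ‖u‖ / Real.sqrt d with hκ
  have hκ0 : 0 ≤ κ := by positivity
  set A := {y : EuclideanSpace ℝ (Fin d) | ‖y‖ < 1 ∧ 0 ≤ inner ℝ y p ∧ 0 ≤ inner ℝ y q} with hA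
  -- Discarding `C` bounds the cross term in `‖u + R y‖²` by `2κ = 6‖u‖/√d`, which `hRu` pays for.
  -- The quadrant has a quarter of the volume and `C` at most `exp (-9/2) ≤ 1/8`; `18 ≤ d` makes the
  -- cap bound applicable at height `3/√d`.
  set C := {y : EuclideanSpace ℝ (Fin d) | ‖y‖ < 1 ∧ κ < inner ℝ y u} with hC
  have hAV : ENNReal.ofReal (1 / 4) * V ≤ volume A := by
    have h := volume_ball_le_four_mul_quadrant p q hp hq hpq
    calc _ ≤ ENNReal.ofReal (1 / 4) * (4 * volume A) := by gcongr
      _ = volume A := by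
        rw [← mul_assoc, ← ENNReal.ofReal_ofNat 4, ← ENNReal.ofReal_mul (by norm_num)]
        norm_num
  have hCV : volume C ≤ ENNReal.ofReal (1 / 8) * V := by
    rcases eq_or_ne u 0 with hu | hu
    · have : C = ∅ := by
        ext y; simp [hC, hu, hκ]
      simp [this]
    · have hun : 0 < ‖u‖ := norm_pos_iff.2 hu
      have h := volume_cone_inter_ball_le (‖u‖⁻¹ • u) (by simp [norm_smul, hun.ne'])
        (3 / Real.sqrt d) (by positivity) (by
          rw [div_pow, Real.sq_sqrt hd0.le, div_le_div_iff₀ hd0 (by norm_num)]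
          have : (18 : ℝ) ≤ d := by exact_mod_cast hd
          linarith)
      have hexp : Real.exp (-(d * (3 / Real.sqrt d) ^ 2 / 2)) ≤ 1 / 8 := by
        rw [div_pow, Real.sq_sqrt hd0.le, mul_div_cancel₀ _ hd0.ne', Real.exp_neg,
          inv_eq_one_div]
        apply one_div_le_one_div_of_le (by norm_num)
        have h1 : (2 : ℝ) ≤ Real.exp 1 := by linarith [Real.add_one_le_exp (1 : ℝ)]
        calc (8 : ℝ) = 2 ^ 3 := by norm_num
          _ ≤ Real.exp 1 ^ 3 := by gcongr
          _ = Real.exp 3 := by rw [← Real.exp_nat_mul]; norm_num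
          _ ≤ _ := Real.exp_le_exp.2 (by norm_num)
      refine (measure_mono ?_).trans (h.trans (by gcongr))
      rintro y ⟨hy1, hy2⟩
      refine ⟨?_, by simpa using hy1⟩
      simp only [Set.mem_ofPred_eq, inner_smul_right]
      rw [hκ] at hy2
      calc 3 / Real.sqrt d * ‖y‖ ≤ 3 / Real.sqrt d * 1 := by gcongr
        _ = ‖u‖⁻¹ * (3 * ‖u‖ / Real.sqrt d) := by field_simp
        _ ≤ _ := by gcongr
  have hQ : ENNReal.ofReal (1 / 8) * V ≤ volume (A \ C) := by
    have h1 : ENNReal.ofReal (1 / 4) * V ≤ volume (A \ C) + ENNReal.ofReal (1 / 8) * V := by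
      refine hAV.trans ((measure_mono ?_).trans ((measure_union_le (A \ C) C).trans ?_))
      · intro y hy; by_cases h : y ∈ C <;> simp [h, hy]
      · gcongr
    have h2 : ENNReal.ofReal (1 / 4) * V =
        ENNReal.ofReal (1 / 8) * V + ENNReal.ofReal (1 / 8) * V := by
      rw [← add_mul, ← ENNReal.ofReal_add (by norm_num) (by norm_num)]; norm_num
    rw [h2] at h1
    exact (ENNReal.add_le_add_iff_right
      (ENNReal.mul_ne_top ENNReal.ofReal_ne_top measure_ball_lt_top.ne)).1 h1
  have hR1 : R ≤ 1 := by
    have : 0 ≤ 6 * ‖u‖ / Real.sqrt d := by positivity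
    nlinarith [sq_nonneg ‖u‖]
  calc ENNReal.ofReal (R ^ d / 8) * V = ENNReal.ofReal (R ^ d) * (ENNReal.ofReal (1 / 8) * V) := by
        rw [← mul_assoc, ← ENNReal.ofReal_mul (by positivity)]; ring_nf
    _ ≤ ENNReal.ofReal (R ^ d) * volume (A \ C) := by gcongr
    _ = volume ((fun x => u + x) '' (R • (A \ C))) := by
        rw [Set.image_add_left, measure_preimage_add, Measure.addHaar_smul,
          finrank_euclideanSpace_fin, abs_of_pos (by positivity)]
    _ ≤ _ := by
        refine measure_mono ?_
        rintro _ ⟨_, ⟨y, ⟨⟨hy1, hyp, hyq⟩, hyC⟩, rfl⟩, rfl⟩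
        have hyu : inner ℝ y u ≤ κ := by
          by_contra h
          exact hyC ⟨hy1, not_le.1 h⟩
        simp only [Set.mem_ofPred_eq, inner_add_left, inner_smul_left, conj_trivial]
        refine ⟨?_, by nlinarith, by nlinarith⟩
        have h1 : ‖u + R • y‖ ^ 2 = ‖u‖ ^ 2 + 2 * R * inner ℝ y u + R ^ 2 * ‖y‖ ^ 2 := by
          rw [norm_add_sq_real, inner_smul_right, norm_smul, Real.norm_of_nonneg hR.le,
            real_inner_comm y u]
          ring
        have h2 : 6 * ‖u‖ / Real.sqrt d = 2 * κ := by rw [hκ]; ring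
        refine lt_of_pow_lt_pow_left₀ 2 zero_le_one ?_
        have h3 : ‖y‖ ^ 2 < 1 := by nlinarith [norm_nonneg y]
        nlinarith [mul_le_mul_of_nonneg_left hyu hR.le, mul_le_mul_of_nonneg_right hR1 hκ0,
          mul_lt_mul_of_pos_left h3 (sq_pos_of_pos hR)]

theorem uniformSphere_quadrant_ge {d : ℕ} (hd : 18 ≤ d) (p q u : EuclideanSpace ℝ (Fin d))
    (hp : ‖p‖ = 1) (hq : ‖q‖ = 1) (hpq : 0 ≤ inner ℝ p q) (hup : 0 ≤ inner ℝ u p)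
    (huq : 0 ≤ inner ℝ u q) (R : ℝ) (hR : 0 < R)
    (hRu : R ^ 2 + ‖u‖ ^ 2 + 6 * ‖u‖ / Real.sqrt d ≤ 1) :
    ENNReal.ofReal (R ^ d / 8) ≤ uniformSphere d {x | inner ℝ u p ≤ inner ℝ (x : EuclideanSpace ℝ (Fin d)) p ∧
      inner ℝ u q ≤ inner ℝ (x : EuclideanSpace ℝ (Fin d)) q} := by
  have hV0 : volume (Metric.ball (0 : EuclideanSpace ℝ (Fin d)) 1) ≠ 0 :=
    (Metric.measure_ball_pos _ _ one_pos).ne'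
  have hVt : volume (Metric.ball (0 : EuclideanSpace ℝ (Fin d)) 1) ≠ ⊤ := measure_ball_lt_top.ne
  have h := uniformSphere_cone (by omega : 1 ≤ d)
    ({x : EuclideanSpace ℝ (Fin d) | inner ℝ u p * ‖x‖ ≤ inner ℝ x p} ∩
      {x : EuclideanSpace ℝ (Fin d) | inner ℝ u q * ‖x‖ ≤ inner ℝ x q})
    ((measurableSet_cap_cone _ _).inter (measurableSet_cap_cone _ _)) (by
      rintro r hr x ⟨hx1, hx2⟩
      simp only [Set.mem_inter_iff, Set.mem_ofPred_eq] at hx1 hx2 ⊢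
      rw [norm_smul, inner_smul_left, inner_smul_left, Real.norm_of_nonneg hr.le]
      simp only [conj_trivial]
      constructor <;> nlinarith)
  have hset : {x : UnitSphere d | inner ℝ u p ≤ inner ℝ (x : EuclideanSpace ℝ (Fin d)) p ∧
      inner ℝ u q ≤ inner ℝ (x : EuclideanSpace ℝ (Fin d)) q} =
      {x : UnitSphere d | (x : EuclideanSpace ℝ (Fin d)) ∈
        ({x : EuclideanSpace ℝ (Fin d) | inner ℝ u p * ‖x‖ ≤ inner ℝ x p} ∩
      {x : EuclideanSpace ℝ (Fin d) | inner ℝ u q * ‖x‖ ≤ inner ℝ x q})} := by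
    ext x; simp
  rw [hset, h, mul_comm, ← div_eq_mul_inv, ENNReal.le_div_iff_mul_le (Or.inl hV0) (Or.inl hVt)]
  refine (volume_shifted_quadrant_ge hd p q u hp hq hpq R hR hRu).trans (measure_mono ?_)
  rintro x ⟨hx1, hx2, hx3⟩
  refine ⟨⟨?_, ?_⟩, by simpa using hx1⟩ <;> simp only [Set.mem_ofPred_eq] <;>
    nlinarith [norm_nonneg x]

/-- Both inequalities together force `⟨u, A v + B q⟩ ≥ A² + B²`, a single cap around the direction
of `A v + B q`, whose squared norm is at most `A² + B² + 2ABθ`. -/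
theorem uniformSphere_two_caps_le {d : ℕ} (hd : 1 ≤ d) (v q : EuclideanSpace ℝ (Fin d))
    (hv : ‖v‖ = 1) (hq : ‖q‖ = 1) (A B θ : ℝ) (hA : 0 < A) (hB : 0 < B) (hθ : 0 ≤ θ)
    (hvq : inner ℝ v q ≤ θ) (hAB : A ^ 2 + B ^ 2 ≤ 1 / 2) :
    uniformSphere d {u | A ≤ inner ℝ (u : EuclideanSpace ℝ (Fin d)) v ∧
        B ≤ inner ℝ (u : EuclideanSpace ℝ (Fin d)) q} ≤
      ENNReal.ofReal (Real.exp (-(d * ((A ^ 2 + B ^ 2) ^ 2 /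
        (A ^ 2 + B ^ 2 + 2 * A * B * θ)) / 2))) := by
  set K := A ^ 2 + B ^ 2 + 2 * A * B * θ with hK
  set z := A • v + B • q with hz
  have hABθ : 0 ≤ 2 * A * B * θ := by positivity
  have hK0 : 0 < K := by positivity
  have hsK : 0 < Real.sqrt K := Real.sqrt_pos.2 hK0
  have hz2 : ‖z‖ ^ 2 ≤ K := by
    rw [hz, norm_add_sq_real, norm_smul, norm_smul, hv, hq, inner_smul_left, inner_smul_right,
      Real.norm_of_nonneg hA.le, Real.norm_of_nonneg hB.le, hK]
    simp only [conj_trivial]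
    nlinarith [mul_le_mul_of_nonneg_left hvq (mul_pos hA hB).le]
  have hzK : ‖z‖ ≤ Real.sqrt K := Real.le_sqrt_of_sq_le hz2
  have hin : ∀ u : UnitSphere d, A ≤ inner ℝ (u : EuclideanSpace ℝ (Fin d)) v →
      B ≤ inner ℝ (u : EuclideanSpace ℝ (Fin d)) q →
      A ^ 2 + B ^ 2 ≤ inner ℝ (u : EuclideanSpace ℝ (Fin d)) z := by
    intro u h1 h2
    rw [hz, inner_add_right, inner_smul_right, inner_smul_right]
    nlinarith
  rcases eq_or_ne z 0 with h0 | h0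
  · have : {u : UnitSphere d | A ≤ inner ℝ (u : EuclideanSpace ℝ (Fin d)) v ∧
        B ≤ inner ℝ (u : EuclideanSpace ℝ (Fin d)) q} = ∅ := by
      refine Set.eq_empty_iff_forall_notMem.2 fun u hu => ?_
      have := hin u hu.1 hu.2
      rw [h0, inner_zero_right] at this
      nlinarith
    rw [this]; simp
  have hz0 : 0 < ‖z‖ := norm_pos_iff.2 h0
  have ht2 : ((A ^ 2 + B ^ 2) / Real.sqrt K) ^ 2 = (A ^ 2 + B ^ 2) ^ 2 / K := by
    rw [div_pow, Real.sq_sqrt hK0.le]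
  have h := uniformSphere_cap_le hd (‖z‖⁻¹ • z) (by simp [norm_smul, hz0.ne'])
    ((A ^ 2 + B ^ 2) / Real.sqrt K) (by positivity) (by
      rw [ht2, div_le_iff₀ hK0]
      nlinarith [sq_nonneg A, sq_nonneg B])
  rw [ht2] at h
  refine (measure_mono ?_).trans h
  rintro u ⟨h1, h2⟩
  have h3 := hin u h1 h2
  simp only [Set.mem_ofPred_eq, inner_smul_right]
  calc (A ^ 2 + B ^ 2) / Real.sqrt K ≤ (A ^ 2 + B ^ 2) / ‖z‖ := by gcongr
    _ = ‖z‖⁻¹ * (A ^ 2 + B ^ 2) := by ring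
    _ ≤ _ := by gcongr

/-! ### Resampling one coordinate of a product measure -/

open Classical in
theorem prod_ite_mem_eq {ι X : Type*} (R : ι → Set (ι → X)) (J : Finset ι) (t : ℝ) (x : ι → X) :
    ∏ j ∈ J, (if x ∈ R j then ENNReal.ofReal (Real.exp t) else 1) =
      ENNReal.ofReal (Real.exp (t * (J.filter fun j => x ∈ R j).card)) := by
  rw [Finset.prod_ite, Finset.prod_const, Finset.prod_const_one, mul_one,
    ← ENNReal.ofReal_pow (Real.exp_pos _).le, ← Real.exp_nat_mul, mul_comm]

section Resampling

open scoped ENNReal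

variable {ι X : Type*} [Fintype ι] [DecidableEq ι] [MeasurableSpace X]

theorem lintegral_pi_update (μ : ι → Measure X) [∀ j, IsProbabilityMeasure (μ j)]
    (f : (ι → X) → ℝ≥0∞) (hf : Measurable f) (u : ι) :
    ∫⁻ x, ∫⁻ y, f (Function.update x u y) ∂(μ u) ∂(Measure.pi μ) = ∫⁻ x, f x ∂(Measure.pi μ) := by
  have hm : Measurable fun x : ι → X => ∫⁻ y, f (Function.update x u y) ∂(μ u) := by
    have := hf.lmarginal (s := {u}) μ
    simpa only [lmarginal_singleton] using this
  refine lintegral_eq_of_lmarginal_eq {u} hm hf ?_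
  rw [lmarginal_singleton, lmarginal_singleton]
  ext x
  simp

/-- Fubini in the coordinate `u`, phrased as resampling: `C` bounds the conditional expectation of
`g` given the other coordinates, needed only where the weight `f` does not vanish. -/
theorem lintegral_pi_mul_le (μ : ι → Measure X) [∀ j, IsProbabilityMeasure (μ j)]
    (f g : (ι → X) → ℝ≥0∞) (hf : Measurable f) (hg : Measurable g) (u : ι) (C : ℝ≥0∞)
    (hfu : ∀ x y, f (Function.update x u y) = f x)
    (hgu : ∀ x, f x ≠ 0 → ∫⁻ y, g (Function.update x u y) ∂(μ u) ≤ C) :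
    ∫⁻ x, f x * g x ∂(Measure.pi μ) ≤ C * ∫⁻ x, f x ∂(Measure.pi μ) := by
  rw [← lintegral_pi_update μ (fun x => f x * g x) (hf.mul hg) u, ← lintegral_const_mul _ hf]
  refine lintegral_mono fun x => ?_
  simp only [hfu]
  have hgm : Measurable fun y => g (Function.update x u y) := hg.comp (measurable_update x)
  rw [lintegral_const_mul _ hgm]
  rcases eq_or_ne (f x) 0 with h | h
  · simp [h]
  · rw [mul_comm]; gcongr; exact hgu x h

theorem pi_inter_le (μ : ι → Measure X) [∀ j, IsProbabilityMeasure (μ j)]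
    (E F : Set (ι → X)) (hE : MeasurableSet E) (hF : MeasurableSet F) (u : ι) (C : ℝ≥0∞)
    (hEu : ∀ x y, Function.update x u y ∈ E ↔ x ∈ E)
    (hFu : ∀ x ∈ E, μ u {y | Function.update x u y ∈ F} ≤ C) :
    Measure.pi μ (E ∩ F) ≤ C * Measure.pi μ E := by
  have h := lintegral_pi_mul_le μ (E.indicator 1) (F.indicator 1)
    (measurable_one.indicator hE) (measurable_one.indicator hF) u C
    (fun x y => by
      by_cases h : x ∈ E
      · rw [Set.indicator_of_mem h, Set.indicator_of_mem ((hEu x y).2 h)]; rfl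
      · rw [Set.indicator_of_notMem h, Set.indicator_of_notMem (fun h' => h ((hEu x y).1 h'))]) (fun x hx => by
      have hxE : x ∈ E := by
        by_contra h; simp [h] at hx
      have hs : MeasurableSet {y | Function.update x u y ∈ F} := measurable_update x hF
      calc ∫⁻ y, F.indicator 1 (Function.update x u y) ∂(μ u)
          = ∫⁻ y, {y | Function.update x u y ∈ F}.indicator 1 y ∂(μ u) := rfl
        _ = μ u {y | Function.update x u y ∈ F} := lintegral_indicator_one hs
        _ ≤ C := hFu x hxE)
  rw [lintegral_indicator_one hE] at h
  convert h using 1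
  rw [← lintegral_indicator_one (hE.inter hF), Set.inter_indicator_one]
  rfl

/-- The factors are integrated one at a time, each over its own coordinate. Invariance is required
only under changes of coordinates in `J`, so the factors may share coordinates outside `J`: this is
conditional independence given those. -/
theorem lintegral_pi_prod_le (μ : ι → Measure X) [∀ j, IsProbabilityMeasure (μ j)]
    (g : ι → (ι → X) → ℝ≥0∞) (hg : ∀ j, Measurable (g j)) (C : ℝ≥0∞) (J : Finset ι)
    (hinv : ∀ j ∈ J, ∀ k ∈ J, k ≠ j → ∀ x y, g j (Function.update x k y) = g j x)
    (hC : ∀ j ∈ J, ∀ x, ∫⁻ y, g j (Function.update x j y) ∂(μ j) ≤ C) :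
    ∫⁻ x, ∏ j ∈ J, g j x ∂(Measure.pi μ) ≤ C ^ J.card := by
  induction J using Finset.induction_on with
  | empty => simp
  | insert a J ha ih =>
    simp only [Finset.prod_insert ha, Finset.card_insert_of_notMem ha]
    have h := lintegral_pi_mul_le μ (fun x => ∏ j ∈ J, g j x) (g a)
      (Finset.measurable_prod _ fun j _ => hg j) (hg a) a C
      (fun x y => Finset.prod_congr rfl fun j hj =>
        hinv j (Finset.mem_insert_of_mem hj) a (Finset.mem_insert_self a J)
          (fun h => ha (h ▸ hj)) x y)
      (fun x _ => hC a (Finset.mem_insert_self a J) x)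
    have ih' := ih (fun j hj k hk => hinv j (Finset.mem_insert_of_mem hj) k
      (Finset.mem_insert_of_mem hk)) (fun j hj => hC j (Finset.mem_insert_of_mem hj))
    calc _ = ∫⁻ x, (∏ j ∈ J, g j x) * g a x ∂(Measure.pi μ) := by simp only [mul_comm]
      _ ≤ C * C ^ J.card := h.trans (by gcongr)
      _ = _ := by rw [pow_succ, mul_comm]

theorem lintegral_ite_mem {μ : Measure X} [IsProbabilityMeasure μ] {S : Set X}
    [DecidablePred (· ∈ S)] (hS : MeasurableSet S) (a : ℝ) (ha : 0 ≤ a) :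
    ∫⁻ y, (if y ∈ S then ENNReal.ofReal a else 1) ∂μ = ENNReal.ofReal (1 + (a - 1) * μ.real S) := by
  rw [← lintegral_add_compl _ hS,
    setLIntegral_congr_fun hS (g := fun _ => ENNReal.ofReal a) (fun y hy => by simp_all),
    setLIntegral_congr_fun hS.compl (g := fun _ => 1) (fun y hy => by simp_all)]
  simp only [lintegral_const, Measure.restrict_apply_univ, one_mul]
  have h1 : μ.real S ≤ 1 := measureReal_le_one
  rw [← ofReal_measureReal (μ := μ) (s := S), ← ofReal_measureReal (μ := μ) (s := Sᶜ),
    ← ENNReal.ofReal_mul ha, ← ENNReal.ofReal_add (by positivity) (by positivity),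
    probReal_compl_eq_one_sub hS]
  congr 1; ring

open Classical in
-- Chernoff bound: each factor `e^1_R` has conditional mean at most `1 + (e - 1) p ≤ e^(2p)`.
theorem pi_count_ge_le (μ : ι → Measure X) [∀ j, IsProbabilityMeasure (μ j)]
    (R : ι → Set (ι → X)) (hR : ∀ j, MeasurableSet (R j)) (J : Finset ι) (p : ℝ)
    (hinv : ∀ j ∈ J, ∀ k ∈ J, k ≠ j → ∀ x y, Function.update x k y ∈ R j ↔ x ∈ R j)
    (hp : ∀ j ∈ J, ∀ x, (μ j).real {y | Function.update x j y ∈ R j} ≤ p) (k : ℝ) :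
    Measure.pi μ {x | k ≤ ((J.filter fun j => x ∈ R j).card : ℝ)} ≤
      ENNReal.ofReal (Real.exp (2 * (J.card * p) - k)) := by
  have h := lintegral_pi_prod_le μ
    (fun j x => if x ∈ R j then ENNReal.ofReal (Real.exp 1) else 1)
    (fun j => Measurable.ite (hR j) measurable_const measurable_const)
    (ENNReal.ofReal (Real.exp (2 * p))) J
    (fun j hj k hk hkj x y => by simp only [hinv j hj k hk hkj x y])
    (fun j hj x => by
      have := lintegral_ite_mem (μ := μ j) (S := {y | Function.update x j y ∈ R j})
        (measurable_update x (hR j)) (Real.exp 1) (Real.exp_pos _).le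
      simp only [Set.mem_ofPred_eq] at this
      rw [this]
      apply ENNReal.ofReal_le_ofReal
      have h1 := hp j hj x
      have h2 := Real.exp_one_lt_d9
      have h3 := Real.add_one_le_exp (2 * p)
      have h4 : 0 ≤ (μ j).real {y | Function.update x j y ∈ R j} := measureReal_nonneg
      nlinarith)
  simp only [prod_ite_mem_eq, one_mul] at h
  rw [← ENNReal.ofReal_pow (Real.exp_pos _).le, ← Real.exp_nat_mul] at h
  have hk : 0 < Real.exp k := Real.exp_pos k
  have h5 : ENNReal.ofReal (Real.exp k) *
      Measure.pi μ {x | k ≤ ((J.filter fun j => x ∈ R j).card : ℝ)} ≤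
      ENNReal.ofReal (Real.exp (J.card * (2 * p))) := by
    refine le_trans ?_ h
    refine le_trans ?_ (mul_meas_ge_le_lintegral₀ ?_ (ENNReal.ofReal (Real.exp k)))
    · gcongr with y
      intro hx
      exact ENNReal.ofReal_le_ofReal (Real.exp_le_exp.2 hx)
    · have : Measurable fun x : ι → X =>
          ∏ j ∈ J, (if x ∈ R j then ENNReal.ofReal (Real.exp 1) else 1) :=
        Finset.measurable_prod _ fun j _ => Measurable.ite (hR j) measurable_const measurable_const
      simp only [prod_ite_mem_eq, one_mul] at this
      exact this.aemeasurable
  rw [mul_comm, ← ENNReal.le_div_iff_mul_le (by simp [hk]) (by simp),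
    ← ENNReal.ofReal_div_of_pos hk, ← Real.exp_sub] at h5
  convert h5 using 4
  ring

open Classical in
-- Chernoff bound with `e^(-1_R)`: since `1 - 1/e > 5/8`, each factor has conditional mean at most
-- `e^(-5p/8)`, and `5/8 - 1/2 = 1/8`.
theorem pi_count_le_le (μ : ι → Measure X) [∀ j, IsProbabilityMeasure (μ j)]
    (R : ι → Set (ι → X)) (hR : ∀ j, MeasurableSet (R j)) (J : Finset ι) (p : ℝ)
    (hinv : ∀ j ∈ J, ∀ k ∈ J, k ≠ j → ∀ x y, Function.update x k y ∈ R j ↔ x ∈ R j)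
    (hp : ∀ j ∈ J, ∀ x, p ≤ (μ j).real {y | Function.update x j y ∈ R j}) :
    Measure.pi μ {x | ((J.filter fun j => x ∈ R j).card : ℝ) ≤ J.card * p / 2} ≤
      ENNReal.ofReal (Real.exp (-(J.card * p / 8))) := by
  have h := lintegral_pi_prod_le μ
    (fun j x => if x ∈ R j then ENNReal.ofReal (Real.exp (-1)) else 1)
    (fun j => Measurable.ite (hR j) measurable_const measurable_const)
    (ENNReal.ofReal (Real.exp (-(5 / 8 * p)))) J
    (fun j hj k hk hkj x y => by simp only [hinv j hj k hk hkj x y])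
    (fun j hj x => by
      have := lintegral_ite_mem (μ := μ j) (S := {y | Function.update x j y ∈ R j})
        (measurable_update x (hR j)) (Real.exp (-1)) (Real.exp_pos _).le
      simp only [Set.mem_ofPred_eq] at this
      rw [this]
      apply ENNReal.ofReal_le_ofReal
      have h1 := hp j hj x
      have h2 := Real.exp_neg_one_lt_d9
      have h3 := Real.add_one_le_exp (-(5 / 8 * p))
      have h4 : 0 ≤ (μ j).real {y | Function.update x j y ∈ R j} := measureReal_nonneg
      nlinarith)
  simp only [prod_ite_mem_eq] at h
  rw [← ENNReal.ofReal_pow (Real.exp_pos _).le, ← Real.exp_nat_mul] at h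
  set k : ℝ := -1 * (J.card * p / 2) with hk'
  have hk : 0 < Real.exp k := Real.exp_pos k
  have h5 : ENNReal.ofReal (Real.exp k) *
      Measure.pi μ {x | ((J.filter fun j => x ∈ R j).card : ℝ) ≤ J.card * p / 2} ≤
      ENNReal.ofReal (Real.exp (J.card * -(5 / 8 * p))) := by
    refine le_trans ?_ h
    refine le_trans ?_ (mul_meas_ge_le_lintegral₀ ?_ (ENNReal.ofReal (Real.exp k)))
    · gcongr with y
      intro hx
      refine ENNReal.ofReal_le_ofReal (Real.exp_le_exp.2 ?_)
      linarith
    · have : Measurable fun x : ι → X =>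
          ∏ j ∈ J, (if x ∈ R j then ENNReal.ofReal (Real.exp (-1)) else 1) :=
        Finset.measurable_prod _ fun j _ => Measurable.ite (hR j) measurable_const measurable_const
      simp only [prod_ite_mem_eq] at this
      exact this.aemeasurable
  rw [mul_comm, ← ENNReal.le_div_iff_mul_le (by simp [hk]) (by simp),
    ← ENNReal.ofReal_div_of_pos hk, ← Real.exp_sub] at h5
  convert h5 using 4
  rw [hk']; ring

end Resampling

/-! ### Independent uniform starting points -/

theorem isProbabilityMeasure_coinLaw (n : ℕ) [Nonempty (Fin n)] :
    IsProbabilityMeasure (coinLaw n) := by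
  have := isProbabilityMeasure_uniformOn (Set.finite_univ (α := Fin n)) Set.univ_nonempty
  unfold coinLaw
  infer_instance

theorem coinLaw_forall_lt_notMem {n : ℕ} [Nonempty (Fin n)] (F : Finset (Fin n)) (D : ℕ) :
    coinLaw n {ω | ∀ t < D, ω t ∉ F} ≤
      ENNReal.ofReal (Real.exp (-((F.card : ℝ) / n * D))) := by
  have := isProbabilityMeasure_uniformOn (Set.finite_univ (α := Fin n)) Set.univ_nonempty
  have hn : 0 < n := Fin.pos_iff_nonempty.2 inferInstance
  have hset : {ω : ℕ → Fin n | ∀ t < D, ω t ∉ F} =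
      Set.pi (↑(Finset.range D)) (fun _ => ((F : Set (Fin n))ᶜ)) := by
    ext ω; simp [Set.pi]
  have hone : uniformOn (Set.univ : Set (Fin n)) ((F : Set (Fin n))ᶜ) ≤
      ENNReal.ofReal (Real.exp (-((F.card : ℝ) / n))) := by
    have hreal : (uniformOn (Set.univ : Set (Fin n))).real ((F : Set (Fin n))ᶜ) =
        1 - (F.card : ℝ) / n := by
      rw [probReal_compl_eq_one_sub F.measurableSet, measureReal_def, uniformOn_univ,
        Measure.count_apply_finset, ENNReal.toReal_div]
      simp
    rw [← ofReal_measureReal (μ := uniformOn (Set.univ : Set (Fin n))), hreal]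
    apply ENNReal.ofReal_le_ofReal
    linarith [Real.add_one_le_exp (-((F.card : ℝ) / n))]
  rw [hset, coinLaw, Measure.infinitePi_pi _ (fun _ _ => F.measurableSet.compl), Finset.prod_const,
    Finset.card_range]
  calc _ ≤ ENNReal.ofReal (Real.exp (-((F.card : ℝ) / n))) ^ D := by gcongr
    _ = _ := by
      rw [← ENNReal.ofReal_pow (Real.exp_pos _).le, ← Real.exp_nat_mul]
      congr 2; ring

open Classical in
-- The coins are independent of the data, so the bound for `D` misses at a fixed data set is
-- integrated over the data.
theorem prod_coinLaw_miss_le {Ω : Type*} [MeasurableSpace Ω] (P : Measure Ω)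
    [IsProbabilityMeasure P] {n : ℕ} [Nonempty (Fin n)] (A : Fin n → Set Ω)
    (hA : ∀ v, MeasurableSet (A v)) (r : ℝ) (D : ℕ) :
    (P.prod (coinLaw n)) {s | r * n ≤ ((Finset.univ.filter fun v => s.1 ∈ A v).card : ℝ) ∧
      ∀ t < D, s.1 ∉ A (s.2 t)} ≤ ENNReal.ofReal (Real.exp (-(r * D))) := by
  have := isProbabilityMeasure_coinLaw n
  have hn : 0 < n := Fin.pos_iff_nonempty.2 inferInstance
  have hm1 : Measurable fun y : Ω => ((Finset.univ.filter fun v => y ∈ A v).card : ℝ) := by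
    have : (fun y : Ω => ((Finset.univ.filter fun v => y ∈ A v).card : ℝ)) =
        fun y => ∑ v, if y ∈ A v then (1 : ℝ) else 0 := by
      ext y; simp
    rw [this]
    exact Finset.measurable_sum _ fun v _ => Measurable.ite (hA v) measurable_const measurable_const
  have hm : MeasurableSet {s : Ω × (ℕ → Fin n) |
      r * n ≤ ((Finset.univ.filter fun v => s.1 ∈ A v).card : ℝ) ∧ ∀ t < D, s.1 ∉ A (s.2 t)} := by
    refine (measurableSet_le measurable_const (hm1.comp measurable_fst)).inter ?_
    have : {s : Ω × (ℕ → Fin n) | ∀ t < D, s.1 ∉ A (s.2 t)} =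
        ⋂ t : ℕ, ⋂ _ : t < D, (⋃ v, (A v) ×ˢ {ω : ℕ → Fin n | ω t = v})ᶜ := by
      ext s
      simp only [Set.mem_ofPred_eq, Set.mem_iInter, Set.mem_compl_iff, Set.mem_iUnion,
        Set.mem_prod, not_exists, not_and]
      exact ⟨fun h t ht v hv hvt => h t ht (hvt ▸ hv), fun h t ht hv => h t ht _ hv rfl⟩
    show MeasurableSet {s : Ω × (ℕ → Fin n) | ∀ t < D, s.1 ∉ A (s.2 t)}
    rw [this]
    refine MeasurableSet.iInter fun t => MeasurableSet.iInter fun _ => MeasurableSet.compl <|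
      MeasurableSet.iUnion fun v => (hA v).prod ?_
    have h1 : Measurable fun ω : ℕ → Fin n => ω t := measurable_pi_apply t
    exact h1 (measurableSet_singleton v)
  rw [Measure.prod_apply hm]
  calc _ ≤ ∫⁻ _, ENNReal.ofReal (Real.exp (-(r * D))) ∂P := by
        refine lintegral_mono fun y => ?_
        by_cases h : r * n ≤ ((Finset.univ.filter fun v => y ∈ A v).card : ℝ)
        · refine (measure_mono (t := {ω | ∀ t < D, ω t ∉ Finset.univ.filter fun v => y ∈ A v})
            ?_).trans ((coinLaw_forall_lt_notMem _ D).trans ?_)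
          · rintro ω ⟨_, hω⟩ t ht
            simpa using hω t ht
          · apply ENNReal.ofReal_le_ofReal
            apply Real.exp_le_exp.2
            have : r ≤ ((Finset.univ.filter fun v => y ∈ A v).card : ℝ) / n := by
              rwa [le_div_iff₀ (by exact_mod_cast hn)]
            have := mul_le_mul_of_nonneg_right this (Nat.cast_nonneg (α := ℝ) D)
            linarith
        · simp [h]
    _ = _ := by simp

/-! ### The greedy walk -/

theorem foldl_scanStep_time {d n : ℕ} (x : Fin n → UnitSphere d) (q : UnitSphere d)
    (l : List (Fin n)) (s : ScanState n) :
    (l.foldl (scanStep x q) s).time = s.time + l.length * (2 * d + 5) := by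
  induction l generalizing s with
  | nil => simp
  | cons a l ih =>
    rw [List.foldl_cons, ih, List.length_cons]
    unfold scanStep
    split_ifs <;> simp <;> ring

theorem foldl_scanStep_progress {d n : ℕ} (x : Fin n → UnitSphere d) (q : UnitSphere d)
    (l : List (Fin n)) (s : ScanState n) :
    ((l.foldl (scanStep x q) s).progress = s.progress ∧ (l.foldl (scanStep x q) s).cur = s.cur) ∨
      ((l.foldl (scanStep x q) s).progress = true ∧
        ip (x s.cur) q + 1 / d ≤ ip (x (l.foldl (scanStep x q) s).cur) q) := by
  have h0 : 0 ≤ 1 / (d : ℝ) := by positivity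
  induction l generalizing s with
  | nil => simp
  | cons a l ih =>
    rw [List.foldl_cons]
    by_cases h : ip (x s.cur) q + 1 / (d : ℝ) ≤ ip (x a) q
    · have hs : scanStep x q s a = ⟨a, true, s.time + (2 * d + 5)⟩ := by simp only [scanStep, if_pos h]
      rw [hs]
      rcases ih ⟨a, true, s.time + (2 * d + 5)⟩ with ⟨h1, h2⟩ | ⟨h1, h2⟩
      · exact Or.inr ⟨h1, by rw [h2]; exact h⟩
      · exact Or.inr ⟨h1, by linarith⟩
    · have hs : scanStep x q s a = ⟨s.cur, s.progress, s.time + (2 * d + 5)⟩ := by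
        simp only [scanStep, if_neg h]
      rw [hs]
      exact ih ⟨s.cur, s.progress, s.time + (2 * d + 5)⟩

/-- A vertex that beats all others in the list by `1 / d` is the outcome for every order of the
list: whatever is current when `w` is read gets replaced, and nothing replaces `w` afterwards. The
first conjunct is the invariant after `w` has been reached. -/
theorem foldl_scanStep_dominant {d n : ℕ} (hd : 0 < d) (x : Fin n → UnitSphere d)
    (q : UnitSphere d) (w : Fin n) (l : List (Fin n))
    (hl : ∀ u ∈ l, u ≠ w → ip (x u) q + 1 / (d : ℝ) ≤ ip (x w) q) (s : ScanState n) :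
    (s.cur = w ∧ s.progress = true → (l.foldl (scanStep x q) s).cur = w ∧
      (l.foldl (scanStep x q) s).progress = true) ∧
    (w ∈ l → ip (x s.cur) q + 1 / (d : ℝ) ≤ ip (x w) q → (l.foldl (scanStep x q) s).cur = w ∧
      (l.foldl (scanStep x q) s).progress = true) := by
  have h0 : 0 < 1 / (d : ℝ) := by positivity
  induction l generalizing s with
  | nil => simp
  | cons a l ih =>
    have hl' : ∀ u ∈ l, u ≠ w → ip (x u) q + 1 / (d : ℝ) ≤ ip (x w) q :=
      fun u hu => hl u (List.mem_cons_of_mem a hu)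
    simp only [List.foldl_cons]
    constructor
    · rintro ⟨h1, h2⟩
      have h : ¬ ip (x s.cur) q + 1 / (d : ℝ) ≤ ip (x a) q := by
        rw [h1]
        by_cases haw : a = w
        · rw [haw]; linarith
        · linarith [hl a List.mem_cons_self haw]
      have hs : scanStep x q s a = ⟨s.cur, s.progress, s.time + (2 * d + 5)⟩ := by
        simp only [scanStep, if_neg h]
      rw [hs]
      exact (ih hl' _).1 ⟨h1, h2⟩
    · intro hw hcur
      by_cases haw : a = w
      · have hs : scanStep x q s a = ⟨a, true, s.time + (2 * d + 5)⟩ := by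
          simp only [scanStep, haw, if_pos hcur]
        rw [hs]
        exact (ih hl' _).1 ⟨haw, rfl⟩
      · have hwl : w ∈ l := by
          rcases List.mem_cons.1 hw with h | h
          · exact absurd h.symm haw
          · exact h
        have ha := hl a List.mem_cons_self haw
        by_cases h : ip (x s.cur) q + 1 / (d : ℝ) ≤ ip (x a) q
        · have hs : scanStep x q s a = ⟨a, true, s.time + (2 * d + 5)⟩ := by simp only [scanStep, if_pos h]
          rw [hs]
          exact (ih hl' _).2 hwl ha
        · have hs : scanStep x q s a = ⟨s.cur, s.progress, s.time + (2 * d + 5)⟩ := by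
            simp only [scanStep, if_neg h]
          rw [hs]
          exact (ih hl' _).2 hwl hcur

section Walk

variable {d n : ℕ} (α : ℝ) (x : Fin n → UnitSphere d) (q : UnitSphere d) (ω : ℕ → Fin n)

theorem queryState_succ (k : ℕ) :
    queryState α x q ω (k + 1) = queryStep α x q ω (queryState α x q ω k) := by
  unfold queryState
  rw [Function.iterate_succ_apply']

theorem queryStep_time (s : QueryState n) :
    (queryStep α x q ω s).time =
      s.time + (2 * d + 1) + 3 + (bucket α x s.cur).length * (2 * d + 5) := by
  simp only [queryStep]
  split_ifs <;> simp only [foldl_scanStep_time]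

theorem queryStep_cases (s : QueryState n) :
    ((queryStep α x q ω s).draws = s.draws ∧
      ip (x s.cur) q + 1 / d ≤ ip (x (queryStep α x q ω s).cur) q) ∨
    ((queryStep α x q ω s).draws = s.draws + 1 ∧ (queryStep α x q ω s).cur = ω s.draws) := by
  simp only [queryStep]
  split_ifs with h
  · rcases foldl_scanStep_progress x q (bucket α x s.cur)
      ⟨s.cur, false, s.time + (2 * d + 1) + 3⟩ with ⟨h1, _⟩ | ⟨_, h2⟩
    · rw [h1] at h; simp at h
    · exact Or.inl ⟨rfl, h2⟩
  · exact Or.inr ⟨rfl, rfl⟩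

theorem queryStep_cur_of_dominant (hd : 0 < d) (s : QueryState n) (w : Fin n)
    (hw : w ∈ bucket α x s.cur)
    (hdom : ∀ u ∈ bucket α x s.cur, u ≠ w → ip (x u) q + 1 / (d : ℝ) ≤ ip (x w) q)
    (hs : ip (x s.cur) q + 1 / (d : ℝ) ≤ ip (x w) q) :
    (queryStep α x q ω s).cur = w := by
  obtain ⟨h1, h2⟩ := (foldl_scanStep_dominant hd x q w _ hdom
    ⟨s.cur, false, s.time + (2 * d + 1) + 3⟩).2 hw hs
  simp only [queryStep, h2, if_true, h1]

theorem abs_ip_le_one (u v : UnitSphere d) : |ip u v| ≤ 1 := by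
  have h := abs_real_inner_le_norm (u : EuclideanSpace ℝ (Fin d)) (v : EuclideanSpace ℝ (Fin d))
  simpa [ip] using h

theorem queryState_time_le (Δ : ℕ) (hΔ : ∀ v, (bucket α x v).length ≤ Δ) (k : ℕ) :
    (queryState α x q ω k).time ≤ 1 + k * (2 * d + 4 + Δ * (2 * d + 5)) := by
  induction k with
  | zero => simp [queryState]
  | succ k ih =>
    rw [queryState_succ, queryStep_time]
    have := Nat.mul_le_mul_right (2 * d + 5) (hΔ (queryState α x q ω k).cur)
    rw [add_mul]
    omega

/-- Every iteration either restarts or gains `1 / d` in a dot product of absolute value at most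
`1`. -/
theorem iterations_le (hd : 0 < d) (k : ℕ) :
    (k : ℝ) ≤ ((queryState α x q ω k).draws - 1) * (2 * d + 1) +
      d * ip (x (queryState α x q ω k).cur) q + d := by
  have hd' : (0 : ℝ) < d := by exact_mod_cast hd
  induction k with
  | zero =>
    have := abs_le.1 (abs_ip_le_one (x (queryState α x q ω 0).cur) q)
    simp only [queryState, Function.iterate_zero, id_eq] at this ⊢
    push_cast
    nlinarith
  | succ k ih =>
    rw [queryState_succ]
    set s := queryState α x q ω k
    push_cast
    rcases queryStep_cases α x q ω s with ⟨h1, h2⟩ | ⟨h1, _⟩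
    · rw [h1]
      have h3 := mul_le_mul_of_nonneg_left h2 hd'.le
      rw [mul_add, mul_one_div_cancel hd'.ne'] at h3
      linarith
    · rw [h1]
      push_cast
      have h3 := (abs_le.1 (abs_ip_le_one (x (queryStep α x q ω s).cur) q)).1
      have h4 := (abs_le.1 (abs_ip_le_one (x s.cur) q)).2
      nlinarith

theorem iterations_lt (hd : 0 < d) (k : ℕ) :
    k < (queryState α x q ω k).draws * (2 * d + 1) := by
  have hd' : (0 : ℝ) < d := by exact_mod_cast hd
  have h := iterations_le α x q ω hd k
  have h4 := (abs_le.1 (abs_ip_le_one (x (queryState α x q ω k).cur) q)).2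
  have : (k : ℝ) < (((queryState α x q ω k).draws * (2 * d + 1) : ℕ) : ℝ) := by
    push_cast; nlinarith
  exact_mod_cast this

/-- `queryState` ignores the exit test, so every draw eventually becomes current; `iterations_lt`
bounds when. -/
theorem exists_queryState_eq_draw (hd : 0 < d) (t : ℕ) :
    ∃ k ≤ t * (2 * d + 1), (queryState α x q ω k).cur = ω t := by
  classical
  -- `draws` starts at `1` for `ω 0`, so `ω t` is the current vertex when `draws` first reaches `t +
  -- 1`.
  have hex : ∃ k, t + 1 ≤ (queryState α x q ω k).draws := by
    refine ⟨t * (2 * d + 1), ?_⟩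
    by_contra h
    have h1 := iterations_lt α x q ω hd (t * (2 * d + 1))
    have h2 : (queryState α x q ω (t * (2 * d + 1))).draws ≤ t := by omega
    have := Nat.mul_le_mul_right (2 * d + 1) h2
    omega
  have hspec := Nat.find_spec hex
  have hmin := fun m => Nat.find_min hex (m := m)
  set k := Nat.find hex
  rcases Nat.eq_zero_or_pos k with hk | hk
  · rw [hk] at hspec
    simp only [queryState, Function.iterate_zero, id_eq] at hspec
    have ht : t = 0 := by omega
    exact ⟨0, Nat.zero_le _, by simp [queryState, ht]⟩
  · obtain ⟨m, hm⟩ : ∃ m, k = m + 1 := ⟨k - 1, by omega⟩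
    have h1 := hmin m (by omega)
    rw [hm, queryState_succ] at hspec
    have h2 := iterations_lt α x q ω hd m
    have h3 : (queryState α x q ω m).draws ≤ t := by omega
    have h4 := Nat.mul_le_mul_right (2 * d + 1) h3
    refine ⟨m + 1, by omega, ?_⟩
    rw [queryState_succ]
    rcases queryStep_cases α x q ω (queryState α x q ω m) with h | h
    · omega
    · rw [h.2]; congr 1; omega

/-- Starting points from which the walk moves to the target `i` in at most two iterations. -/
def IsGoodStart (i v : Fin n) : Prop :=
  v = i ∨ i ∈ bucket α x v ∨ ∃ w, w ∈ bucket α x v ∧ i ∈ bucket α x w ∧ w ≠ i ∧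
    ip (x v) q + 1 / (d : ℝ) ≤ ip (x w) q ∧
    ∀ u ∈ bucket α x v, u ≠ w → ip (x u) q + 1 / (d : ℝ) ≤ ip (x w) q

/-- Without the exit test the walk reaches `i` within two iterations of the good draw. The actual
halting time is no later, and only `i` can pass the exit test, so an earlier stop also returns `i`.
-/
theorem queryReturns_of_goodStart (hd : 0 < d) (γ : ℝ) (i : Fin n) (Δ D : ℕ)
    (hi : γ ≤ ip (x i) q) (hother : ∀ j, j ≠ i → ip (x j) q + 1 / (d : ℝ) ≤ γ)
    (hΔ : ∀ v, (bucket α x v).length ≤ Δ) (t : ℕ) (ht : t < D)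
    (hgood : IsGoodStart α x q i (ω t)) :
    ∃ T, QueryReturns α γ x q ω i T ∧
      T ≤ 1 + (D * (2 * d + 1) + 2) * (2 * d + 4 + Δ * (2 * d + 5)) + (2 * d + 1) := by
  classical
  have h0 : 0 < 1 / (d : ℝ) := by positivity
  obtain ⟨k, hk, hcur⟩ := exists_queryState_eq_draw α x q ω hd t
  have hdomi : ∀ j, j ≠ i → ip (x j) q + 1 / (d : ℝ) ≤ ip (x i) q :=
    fun j hj => (hother j hj).trans hi
  have hstep : ∀ m v, (queryState α x q ω m).cur = v → v ≠ i → i ∈ bucket α x v →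
      (queryState α x q ω (m + 1)).cur = i := by
    intro m v hm hv hiv
    rw [queryState_succ]
    exact queryStep_cur_of_dominant α x q ω hd _ i (by rw [hm]; exact hiv)
      (fun u _ hu => hdomi u hu) (by rw [hm]; exact hdomi v hv)
  have hreach : ∃ m ≤ D * (2 * d + 1) + 2, (queryState α x q ω m).cur = i := by
    have hD : t * (2 * d + 1) ≤ D * (2 * d + 1) := Nat.mul_le_mul_right _ ht.le
    by_cases hv : ω t = i
    · exact ⟨k, by omega, by rw [hcur, hv]⟩
    rcases hgood with h | h | ⟨w, hwv, hiw, hwi, hvw, hdom⟩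
    · exact absurd h hv
    · exact ⟨k + 1, by omega, hstep k _ hcur hv h⟩
    · refine ⟨k + 1 + 1, by omega, hstep (k + 1) w ?_ hwi hiw⟩
      rw [queryState_succ]
      exact queryStep_cur_of_dominant α x q ω hd _ w (by rw [hcur]; exact hwv)
        (by rw [hcur]; exact hdom) (by rw [hcur]; exact hvw)
  obtain ⟨m, hm, hmi⟩ := hreach
  have hex : ∃ m, γ ≤ ip (x (queryState α x q ω m).cur) q := ⟨m, by rw [hmi]; exact hi⟩
  have hfind : Nat.find hex ≤ m := Nat.find_le (by rw [hmi]; exact hi)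
  refine ⟨_, ⟨Nat.find hex, fun j hj => not_le.1 (Nat.find_min hex hj), Nat.find_spec hex, ?_, rfl⟩,
    ?_⟩
  · by_contra h
    linarith [hother _ h, Nat.find_spec hex]
  · have h1 := queryState_time_le α x q ω Δ hΔ (Nat.find hex)
    have h2 : Nat.find hex * (2 * d + 4 + Δ * (2 * d + 5)) ≤
        (D * (2 * d + 1) + 2) * (2 * d + 4 + Δ * (2 * d + 5)) :=
      Nat.mul_le_mul_right _ (hfind.trans hm)
    omega

end Walk

/-! ### The random data set -/

theorem ip_comm {d : ℕ} (u v : UnitSphere d) : ip u v = ip v u := by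
  simp only [ip, real_inner_comm]

theorem Measurable.ip {Ω : Type*} [MeasurableSpace Ω] {d : ℕ} {f g : Ω → UnitSphere d}
    (hf : Measurable f) (hg : Measurable g) : Measurable fun s => ip (f s) (g s) :=
  (measurable_subtype_coe.comp hf).inner (measurable_subtype_coe.comp hg)

open Classical in
theorem mem_bucket {d n : ℕ} (α : ℝ) (x : Fin n → UnitSphere d) (v w : Fin n) :
    w ∈ bucket α x v ↔ v ≠ w ∧ α ≤ ip (x v) (x w) := by
  rw [bucket, List.mem_filter, decide_eq_true_iff]
  exact ⟨fun h => h.2, fun h => ⟨List.mem_finRange w, h⟩⟩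

/-- The laws of the coordinates of `dataLaw`. -/
noncomputable def pointLaw {d n : ℕ} (i : Fin n) (pstar : UnitSphere d) (j : Fin n) :
    Measure (UnitSphere d) :=
  if j = i then Measure.dirac pstar else uniformSphere d

theorem dataLaw_eq {d n : ℕ} (i : Fin n) (pstar : UnitSphere d) :
    dataLaw d n i pstar = Measure.pi (pointLaw i pstar) := rfl

theorem isProbabilityMeasure_pointLaw {d n : ℕ} (hd : 1 ≤ d) (i : Fin n) (pstar : UnitSphere d)
    (j : Fin n) : IsProbabilityMeasure (pointLaw i pstar j) := by
  have := isProbabilityMeasure_uniformSphere hd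
  unfold pointLaw
  split_ifs <;> infer_instance

theorem pointLaw_of_ne {d n : ℕ} {i j : Fin n} (h : j ≠ i) (pstar : UnitSphere d) :
    pointLaw i pstar j = uniformSphere d := if_neg h

theorem isProbabilityMeasure_dataLaw {d n : ℕ} (hd : 1 ≤ d) (i : Fin n) (pstar : UnitSphere d) :
    IsProbabilityMeasure (dataLaw d n i pstar) := by
  have := isProbabilityMeasure_pointLaw hd i pstar
  rw [dataLaw_eq]
  infer_instance

theorem dataLaw_exists_far_le {d n : ℕ} (hd : 1 ≤ d) (i : Fin n) (pstar q : UnitSphere d) (θ : ℝ)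
    (hθ : 0 ≤ θ) (hθ2 : θ ^ 2 ≤ 1 / 2) :
    dataLaw d n i pstar {x | ∃ j, j ≠ i ∧ θ < ip (x j) q} ≤
      ENNReal.ofReal (n * Real.exp (-(d * θ ^ 2 / 2))) := by
  classical
  have := isProbabilityMeasure_pointLaw hd i pstar
  have hq : ‖(q : EuclideanSpace ℝ (Fin d))‖ = 1 := by simp
  rw [dataLaw_eq]
  have hsub : {x : Fin n → UnitSphere d | ∃ j, j ≠ i ∧ θ < ip (x j) q} ⊆
      ⋃ j : Fin n, {x | j ≠ i ∧ θ ≤ ip (x j) q} := by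
    rintro x ⟨j, hj, h⟩
    exact Set.mem_iUnion.2 ⟨j, hj, h.le⟩
  refine (measure_mono hsub).trans ((measure_iUnion_fintype_le _ _).trans ?_)
  calc _ ≤ ∑ _j : Fin n, ENNReal.ofReal (Real.exp (-(d * θ ^ 2 / 2))) := by
        refine Finset.sum_le_sum fun j _ => ?_
        by_cases hj : j = i
        · simp [hj]
        have h := pi_inter_le (pointLaw i pstar) Set.univ {x | θ ≤ ip (x j) q} .univ
          (measurableSet_le measurable_const ((measurable_pi_apply j).ip measurable_const)) j
          (ENNReal.ofReal (Real.exp (-(d * θ ^ 2 / 2)))) (by simp) (fun x _ => by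
            rw [pointLaw_of_ne hj]
            simp only [Set.mem_ofPred_eq, Function.update_self]
            exact uniformSphere_cap_le hd _ hq θ hθ hθ2)
        simpa [hj] using h
    _ = _ := by
      rw [Finset.sum_const, Finset.card_univ, Fintype.card_fin, nsmul_eq_mul,
        ENNReal.ofReal_mul (Nat.cast_nonneg n), ENNReal.ofReal_natCast]

open Classical in
-- The planted vertex is not random and is paid for by the `1`; the points outside `{i, v}` are
-- independent and uniform given `x v`, as the Chernoff bounds require.
theorem bucket_length_le {d n : ℕ} (α : ℝ) (x : Fin n → UnitSphere d) (i v : Fin n) :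
    (bucket α x v).length ≤ 1 + (((Finset.univ \ {i, v}).filter
      fun j => α ≤ ip (x v) (x j)).card) := by
  have h1 : (bucket α x v).length = (Finset.univ.filter fun w => w ∈ bucket α x v).card := by
    have hnd : (bucket α x v).Nodup := (List.nodup_finRange n).filter _
    rw [← List.toFinset_card_of_nodup hnd]
    congr 1
    ext w; simp
  rw [h1, add_comm]
  refine (Finset.card_le_card (t := insert i ((Finset.univ \ {i, v}).filter
    fun j => α ≤ ip (x v) (x j))) ?_).trans (Finset.card_insert_le _ _)
  intro w hw
  simp only [Finset.mem_filter, Finset.mem_univ, true_and, mem_bucket, Finset.mem_insert,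
    Finset.mem_sdiff, Finset.mem_singleton] at hw ⊢
  by_cases h : w = i
  · exact Or.inl h
  · exact Or.inr ⟨fun h' => h'.elim h (fun h' => hw.1 h'.symm), hw.2⟩

theorem dataLaw_exists_bucket_gt_le {d n : ℕ} (hd : 1 ≤ d) (i : Fin n) (pstar : UnitSphere d)
    (α : ℝ) (hα : 0 ≤ α) (hα2 : α ^ 2 ≤ 1 / 2) (k : ℝ) :
    dataLaw d n i pstar {x | ∃ v, 1 + k < (bucket α x v).length} ≤
      ENNReal.ofReal (n * Real.exp (2 * (n * Real.exp (-(d * α ^ 2 / 2))) - k)) := by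
  classical
  have := isProbabilityMeasure_pointLaw hd i pstar
  rw [dataLaw_eq]
  have hsub : {x : Fin n → UnitSphere d | ∃ v, 1 + k < (bucket α x v).length} ⊆
      ⋃ v : Fin n, {x | k ≤ (((Finset.univ \ {i, v}).filter
        fun j => x ∈ {x : Fin n → UnitSphere d | α ≤ ip (x v) (x j)}).card : ℝ)} := by
    rintro x ⟨v, hv⟩
    refine Set.mem_iUnion.2 ⟨v, ?_⟩
    have h : ((bucket α x v).length : ℝ) ≤ _ := Nat.cast_le.2 (bucket_length_le α x i v)
    push_cast at h
    simp only [Set.mem_ofPred_eq]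
    linarith
  refine (measure_mono hsub).trans ((measure_iUnion_fintype_le _ _).trans ?_)
  calc _ ≤ ∑ _v : Fin n,
        ENNReal.ofReal (Real.exp (2 * (n * Real.exp (-(d * α ^ 2 / 2))) - k)) := by
        refine Finset.sum_le_sum fun v _ => ?_
        refine (pi_count_ge_le (pointLaw i pstar) (fun j => {x | α ≤ ip (x v) (x j)})
          (fun j => measurableSet_le measurable_const
            ((measurable_pi_apply v).ip (measurable_pi_apply j))) (Finset.univ \ {i, v})
          (Real.exp (-(d * α ^ 2 / 2))) ?_ ?_ k).trans ?_
        · intro j hj k hk hkj x y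
          simp only [Finset.mem_sdiff, Finset.mem_univ, true_and, Finset.mem_insert,
            Finset.mem_singleton, not_or] at hj hk
          simp only [Set.mem_ofPred_eq, Function.update_of_ne (Ne.symm hk.2),
            Function.update_of_ne (Ne.symm hkj)]
        · intro j hj x
          simp only [Finset.mem_sdiff, Finset.mem_univ, true_and, Finset.mem_insert,
            Finset.mem_singleton, not_or] at hj
          rw [pointLaw_of_ne hj.1]
          simp only [Set.mem_ofPred_eq, Function.update_of_ne (Ne.symm hj.2),
            Function.update_self]
          refine ENNReal.toReal_le_of_le_ofReal (Real.exp_pos _).le ?_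
          have h := uniformSphere_cap_le hd (x v) (by simp) α hα hα2
          simpa only [ip, real_inner_comm] using h
        · gcongr
          exact_mod_cast (Finset.card_le_univ _).trans (by simp)
    _ = _ := by
      rw [Finset.sum_const, Finset.card_univ, Fintype.card_fin, nsmul_eq_mul,
        ENNReal.ofReal_mul (Nat.cast_nonneg n), ENNReal.ofReal_natCast]

open Classical in
/-- If outside of a rare set of data sets there are many good starting points, then the walk
succeeds with high probability. -/
theorem prod_walk_failure_le {d n : ℕ} (hd : 1 ≤ d) (i : Fin n) (pstar q : UnitSphere d)
    (α γ r β : ℝ) (Δ D : ℕ) (A : Fin n → Set (Fin n → UnitSphere d))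
    (hA : ∀ v, MeasurableSet (A v)) (B : Set (Fin n → UnitSphere d))
    (hB : dataLaw d n i pstar B ≤ ENNReal.ofReal β) (hβ : 0 ≤ β)
    (hi : ∀ x ∉ B, γ ≤ ip (x i) q) (hother : ∀ x ∉ B, ∀ j, j ≠ i → ip (x j) q + 1 / (d : ℝ) ≤ γ)
    (hΔ : ∀ x ∉ B, ∀ v, (bucket α x v).length ≤ Δ)
    (hgood : ∀ x ∉ B, ∀ v, x ∈ A v → IsGoodStart α x q i v)
    (hcard : ∀ x ∉ B, r * n ≤ ((Finset.univ.filter fun v => x ∈ A v).card : ℝ)) :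
    1 - (β + Real.exp (-(r * D))) ≤ ((dataLaw d n i pstar).prod (coinLaw n)).real
      {s | (∀ v, (bucket α s.1 v).length ≤ Δ) ∧ ∃ T, QueryReturns α γ s.1 q s.2 i T ∧
        T ≤ 1 + (D * (2 * d + 1) + 2) * (2 * d + 4 + Δ * (2 * d + 5)) + (2 * d + 1)} := by
  have : Nonempty (Fin n) := ⟨i⟩
  have := isProbabilityMeasure_dataLaw hd i pstar
  have := isProbabilityMeasure_coinLaw n
  set S := {s : (Fin n → UnitSphere d) × (ℕ → Fin n) |
    (∀ v, (bucket α s.1 v).length ≤ Δ) ∧ ∃ T, QueryReturns α γ s.1 q s.2 i T ∧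
        T ≤ 1 + (D * (2 * d + 1) + 2) * (2 * d + 4 + Δ * (2 * d + 5)) + (2 * d + 1)} with hS
  have hsub : Sᶜ ⊆ B ×ˢ Set.univ ∪
      {s | r * n ≤ ((Finset.univ.filter fun v => s.1 ∈ A v).card : ℝ) ∧
        ∀ t < D, s.1 ∉ A (s.2 t)} := by
    intro s hs
    by_cases hsB : s.1 ∈ B
    · exact Or.inl ⟨hsB, trivial⟩
    refine Or.inr ⟨hcard _ hsB, fun t ht hA => hs ⟨hΔ _ hsB, ?_⟩⟩
    exact queryReturns_of_goodStart α s.1 q s.2 hd γ i Δ D (hi _ hsB) (hother _ hsB) (hΔ _ hsB) t ht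
      (hgood _ hsB _ hA)
  have h1 : ((dataLaw d n i pstar).prod (coinLaw n)) Sᶜ ≤
      ENNReal.ofReal (β + Real.exp (-(r * D))) := by
    refine (measure_mono hsub).trans ((measure_union_le _ _).trans ?_)
    rw [ENNReal.ofReal_add hβ (Real.exp_pos _).le, Measure.prod_prod, measure_univ, mul_one]
    exact add_le_add hB (prod_coinLaw_miss_le _ A hA r D)
  have h2 : ((dataLaw d n i pstar).prod (coinLaw n)).real Sᶜ ≤ β + Real.exp (-(r * D)) :=
    ENNReal.toReal_le_of_le_ofReal (by positivity) h1
  -- Subadditivity of the outer measure is enough here, so measurability of the success event `S` is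
  -- never needed.
  have h3 : (1 : ℝ) ≤ ((dataLaw d n i pstar).prod (coinLaw n)).real S +
      ((dataLaw d n i pstar).prod (coinLaw n)).real Sᶜ := by
    have h := measureReal_union_le (μ := (dataLaw d n i pstar).prod (coinLaw n)) S Sᶜ
    rwa [Set.union_compl_self, probReal_univ] at h
  linarith

/-! ### Counting relays -/

section Counting

variable {V : Type*} (adj : V → V → Prop) (T H : V → Prop) (i : V)

/-- An edge from `p.1` to a vertex `p.2` with property `T`, avoiding `i`. -/
def IsTargetEdge (p : V × V) : Prop :=
  p.1 ≠ i ∧ p.2 ≠ i ∧ p.1 ≠ p.2 ∧ T p.2 ∧ adj p.1 p.2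

/-- `v` is not in `H`, and has exactly one neighbor in `H`, which moreover is in `T`. -/
def IsRelayStart (v : V) : Prop :=
  ∃ w, IsTargetEdge adj T i (v, w) ∧ ¬ H v ∧ ∀ u, u ≠ i → u ≠ v → u ≠ w → adj v u → ¬ H u

open Classical in
-- An edge that is in neither bad class is determined by its starting vertex, because a second
-- target neighbor would be a second neighbor in `H`. The remaining edges therefore inject into the
-- relay starts.
theorem card_targetEdge_le [Fintype V] (hTH : ∀ v, T v → H v) :
    (Finset.univ.filter fun p : V × V => IsTargetEdge adj T i p).card ≤
      (Finset.univ.filter fun v => IsRelayStart adj T H i v).card +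
      (Finset.univ.filter fun p : V × V => IsTargetEdge adj T i p ∧ H p.1).card +
      (Finset.univ.filter fun s : (V × V) × V => IsTargetEdge adj T i s.1 ∧ s.2 ≠ i ∧ s.2 ≠ s.1.1 ∧
        s.2 ≠ s.1.2 ∧ adj s.1.1 s.2 ∧ H s.2).card := by
  set G := Finset.univ.filter fun p : V × V => IsTargetEdge adj T i p ∧ ¬ H p.1 ∧
    ∀ u, u ≠ i → u ≠ p.1 → u ≠ p.2 → adj p.1 u → ¬ H u with hG
  set B1 := Finset.univ.filter fun p : V × V => IsTargetEdge adj T i p ∧ H p.1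
  set B2 := Finset.univ.filter fun s : (V × V) × V => IsTargetEdge adj T i s.1 ∧ s.2 ≠ i ∧
    s.2 ≠ s.1.1 ∧ s.2 ≠ s.1.2 ∧ adj s.1.1 s.2 ∧ H s.2
  have h1 : (Finset.univ.filter fun p : V × V => IsTargetEdge adj T i p) ⊆
      G ∪ B1 ∪ B2.image Prod.fst := by
    intro p hp
    simp only [G, B1, B2, Finset.mem_filter, Finset.mem_univ, true_and, Finset.mem_union,
      Finset.mem_image] at hp ⊢
    by_cases h2 : H p.1
    · exact Or.inl (Or.inr ⟨hp, h2⟩)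
    by_cases h3 : ∀ u, u ≠ i → u ≠ p.1 → u ≠ p.2 → adj p.1 u → ¬ H u
    · exact Or.inl (Or.inl ⟨hp, h2, h3⟩)
    · push Not at h3
      obtain ⟨u, hu1, hu2, hu3, hu4, hu5⟩ := h3
      exact Or.inr ⟨(p, u), ⟨hp, hu1, hu2, hu3, hu4, hu5⟩, rfl⟩
  have h2 : G.card ≤ (Finset.univ.filter fun v => IsRelayStart adj T H i v).card := by
    refine Finset.card_le_card_of_injOn Prod.fst ?_ ?_
    · intro p hp
      simp only [G, Finset.coe_filter, Finset.mem_univ, true_and, Set.mem_ofPred_eq] at hp ⊢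
      exact ⟨p.2, hp⟩
    · rintro ⟨v, w⟩ hp ⟨v', w'⟩ hp' (hvv : v = v')
      subst hvv
      simp only [G, Finset.coe_filter, Finset.mem_univ, true_and, Set.mem_ofPred_eq] at hp hp'
      by_contra hne
      have hww : w' ≠ w := fun h => hne (by rw [h])
      exact hp.2.2 w' hp'.1.2.1 (Ne.symm hp'.1.2.2.1) hww hp'.1.2.2.2.2 (hTH _ hp'.1.2.2.2.1)
  have h3 : (B2.image Prod.fst).card ≤ B2.card := Finset.card_image_le
  have h4 := Finset.card_le_card h1
  have h5 := Finset.card_union_le (G ∪ B1) (B2.image Prod.fst)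
  have h6 := Finset.card_union_le G B1
  omega

open Classical in
-- Double counting by the target endpoint: at least `a` targets, each with at least `b` neighbors.
theorem card_targetEdge_ge [Fintype V] [DecidableEq V] (hsymm : ∀ v w, adj v w ↔ adj w v) (a b : ℝ) (hb : 0 ≤ b)
    (ha : a ≤ ((Finset.univ \ {i}).filter fun w => T w).card)
    (hdeg : ∀ w, b ≤ ((Finset.univ \ {i, w}).filter fun v => adj w v).card) :
    a * b ≤ (Finset.univ.filter fun p : V × V => IsTargetEdge adj T i p).card := by
  have h : (Finset.univ.filter fun p : V × V => IsTargetEdge adj T i p).card =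
      ∑ w ∈ (Finset.univ \ {i}).filter fun w => T w,
        ((Finset.univ \ {i, w}).filter fun v => adj w v).card := by
    rw [← Finset.card_sigma]
    refine Finset.card_bij' (fun p _ => ⟨p.2, p.1⟩) (fun s _ => (s.2, s.1)) ?_ ?_ ?_ ?_
    · rintro ⟨v, w⟩ hp
      replace hp : IsTargetEdge adj T i (v, w) := (Finset.mem_filter.1 hp).2
      simp only [Finset.mem_sigma, Finset.mem_filter, Finset.mem_sdiff, Finset.mem_univ, true_and,
        Finset.mem_singleton, Finset.mem_insert, not_or]
      exact ⟨⟨hp.2.1, hp.2.2.2.1⟩, ⟨hp.1, hp.2.2.1⟩, (hsymm _ _).1 hp.2.2.2.2⟩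
    · rintro ⟨w, v⟩ hs
      simp only [Finset.mem_sigma, Finset.mem_filter, Finset.mem_sdiff, Finset.mem_univ, true_and,
        Finset.mem_singleton, Finset.mem_insert, not_or] at hs
      exact Finset.mem_filter.2 ⟨Finset.mem_univ _, hs.2.1.1, hs.1.1, hs.2.1.2, hs.1.2, (hsymm _ _).1 hs.2.2⟩
    · intros; rfl
    · intros; rfl
  rw [h]
  push_cast
  calc a * b ≤ (((Finset.univ \ {i}).filter fun w => T w).card : ℝ) * b := by gcongr
    _ = ∑ w ∈ (Finset.univ \ {i}).filter fun w => T w, b := by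
      rw [Finset.sum_const, nsmul_eq_mul]
    _ ≤ _ := Finset.sum_le_sum fun w _ => hdeg w

end Counting

open Classical in
theorem measure_count_ge_le {Ω K : Type*} [MeasurableSpace Ω] [Fintype K] (μ : Measure Ω)
    (E : K → Set Ω) (hE : ∀ k, MeasurableSet (E k)) (p c : ℝ) (hc : 0 < c)
    (hp : ∀ k, μ (E k) ≤ ENNReal.ofReal p) :
    μ {x | c ≤ ((Finset.univ.filter fun k => x ∈ E k).card : ℝ)} ≤
      ENNReal.ofReal (Fintype.card K * p / c) := by
  have hf : Measurable fun x => ∑ k, (E k).indicator (1 : Ω → ENNReal) x :=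
    Finset.measurable_sum _ fun k _ => measurable_one.indicator (hE k)
  have hsum : ∀ x, ∑ k, (E k).indicator (1 : Ω → ENNReal) x =
      ENNReal.ofReal ((Finset.univ.filter fun k => x ∈ E k).card : ℝ) := by
    intro x
    simp [Set.indicator_apply]
  have h := mul_meas_ge_le_lintegral (μ := μ) hf (ENNReal.ofReal c)
  simp only [hsum] at h
  have h2 : ∫⁻ x, ENNReal.ofReal ((Finset.univ.filter fun k => x ∈ E k).card : ℝ) ∂μ ≤
      ENNReal.ofReal (Fintype.card K * p) := by
    simp only [← hsum]
    rw [lintegral_finsetSum _ fun k _ => measurable_one.indicator (hE k)]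
    calc _ = ∑ k, μ (E k) := Finset.sum_congr rfl fun k _ => lintegral_indicator_one (hE k)
      _ ≤ ∑ _k : K, ENNReal.ofReal p := Finset.sum_le_sum fun k _ => hp k
      _ = _ := by
        rw [Finset.sum_const, Finset.card_univ, nsmul_eq_mul,
          ENNReal.ofReal_mul (Nat.cast_nonneg _), ENNReal.ofReal_natCast]
  rw [ENNReal.ofReal_div_of_pos hc, ENNReal.le_div_iff_mul_le (by simp [hc]) (by simp), mul_comm]
  refine le_trans ?_ (h.trans h2)
  gcongr with x
  intro hx
  exact ENNReal.ofReal_le_ofReal hx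

/-! ### Two-step paths to the planted point in the random graph -/

section RelayData

variable {d n : ℕ} (α h t θ : ℝ) (i : Fin n) (pstar q : UnitSphere d)

/-- Points that are near neighbors of `pstar` and progress far towards `q`. -/
def targetRegion : Set (UnitSphere d) := {y | t ≤ ip y q ∧ α ≤ ip y pstar}

/-- Data sets for which `v` is a start of a two-step path to the planted point. -/
def relaySet (v : Fin n) : Set (Fin n → UnitSphere d) :=
  {x | IsRelayStart (fun v w => α ≤ ip (x v) (x w)) (fun w => x w ∈ targetRegion α t pstar q)
    (fun w => h ≤ ip (x w) q) i v}

theorem measurableSet_targetRegion : MeasurableSet (targetRegion α t pstar q) :=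
  (measurableSet_le measurable_const (measurable_id.ip measurable_const)).inter
    (measurableSet_le measurable_const (measurable_id.ip measurable_const))

theorem measurableSet_adj (v w : Fin n) :
    MeasurableSet {x : Fin n → UnitSphere d | α ≤ ip (x v) (x w)} :=
  measurableSet_le measurable_const ((measurable_pi_apply v).ip (measurable_pi_apply w))

theorem measurableSet_high (v : Fin n) :
    MeasurableSet {x : Fin n → UnitSphere d | h ≤ ip (x v) q} :=
  measurableSet_le measurable_const ((measurable_pi_apply v).ip measurable_const)

theorem measurableSet_low (v : Fin n) :
    MeasurableSet {x : Fin n → UnitSphere d | ip (x v) q ≤ θ} :=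
  measurableSet_le ((measurable_pi_apply v).ip measurable_const) measurable_const

theorem measurableSet_target (v : Fin n) :
    MeasurableSet {x : Fin n → UnitSphere d | x v ∈ targetRegion α t pstar q} :=
  measurable_pi_apply v (measurableSet_targetRegion α t pstar q)

theorem measurableSet_targetEdge (p : Fin n × Fin n) :
    MeasurableSet {x : Fin n → UnitSphere d | IsTargetEdge (fun v w => α ≤ ip (x v) (x w))
      (fun w => x w ∈ targetRegion α t pstar q) i p} :=
  (MeasurableSet.const _).inter ((MeasurableSet.const _).inter ((MeasurableSet.const _).inter
    ((measurableSet_target α t pstar q p.2).inter (measurableSet_adj α p.1 p.2))))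

theorem measurableSet_relaySet (v : Fin n) : MeasurableSet (relaySet α h t i pstar q v) := by
  have : relaySet α h t i pstar q v = ⋃ w, ({x : Fin n → UnitSphere d |
      IsTargetEdge (fun v w => α ≤ ip (x v) (x w)) (fun w => x w ∈ targetRegion α t pstar q) i
        (v, w)} ∩ ({x | h ≤ ip (x v) q}ᶜ ∩ ⋂ u, ({x | u ≠ i ∧ u ≠ v ∧ u ≠ w}ᶜ ∪
          ({x | α ≤ ip (x v) (x u)}ᶜ ∪ {x | h ≤ ip (x u) q}ᶜ)))) := by
    ext x
    simp only [relaySet, IsRelayStart, Set.mem_ofPred_eq, Set.mem_iUnion, Set.mem_inter_iff,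
      Set.mem_compl_iff, Set.mem_iInter, Set.mem_union]
    refine exists_congr fun w => and_congr_right fun _ => and_congr_right fun _ =>
      forall_congr' fun u => ?_
    tauto
  rw [this]
  exact MeasurableSet.iUnion fun w => (measurableSet_targetEdge α t i pstar q _).inter
    ((measurableSet_high h q v).compl.inter (MeasurableSet.iInter fun u =>
      (MeasurableSet.const _).compl.union
        ((measurableSet_adj α v u).compl.union (measurableSet_high h q u).compl)))

theorem isGoodStart_of_mem_relaySet (x : Fin n → UnitSphere d) (hx : x i = pstar)
    (hht : h + 1 / (d : ℝ) ≤ t) (v : Fin n) (hv : x ∈ relaySet α h t i pstar q v) :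
    IsGoodStart α x q i v := by
  obtain ⟨w, ⟨hvi, hwi, hvw, ⟨hw1, hw2⟩, hadj⟩, hvh, hu⟩ := hv
  simp only at hvi hwi hvw hw1 hw2 hadj hvh hu
  -- The relay condition says nothing about `u = i`; if `i` is itself a neighbor of `v`, one move
  -- suffices.
  by_cases hiv : i ∈ bucket α x v
  · exact Or.inr (Or.inl hiv)
  refine Or.inr (Or.inr ⟨w, (mem_bucket ..).2 ⟨hvw, hadj⟩,
    (mem_bucket ..).2 ⟨hwi, by rw [hx]; exact hw2⟩, hwi, by linarith, fun u hub huw => ?_⟩)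
  have hub' := (mem_bucket ..).1 hub
  have := hu u (fun hui => hiv (hui ▸ hub)) (Ne.symm hub'.1) huw hub'.2
  linarith

theorem dataLaw_target_le (hd : 1 ≤ d) (w : Fin n) (hw : w ≠ i) :
    dataLaw d n i pstar {x | x w ∈ targetRegion α t pstar q} ≤
      uniformSphere d (targetRegion α t pstar q) := by
  have := isProbabilityMeasure_pointLaw hd i pstar
  rw [dataLaw_eq]
  have h := pi_inter_le (pointLaw i pstar) Set.univ {x | x w ∈ targetRegion α t pstar q} .univ
    (measurableSet_target α t pstar q w) w (uniformSphere d (targetRegion α t pstar q)) (by simp)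
    (fun x _ => by
      rw [pointLaw_of_ne hw]
      simp only [Set.mem_ofPred_eq, Function.update_self]
      exact le_rfl)
  simpa using h

/-- The point `w` is exposed first and `v` resampled. This bounds the target edges whose starting
vertex is already high. -/
theorem dataLaw_high_pair_le (hd : 1 ≤ d) (pB : ENNReal)
    (hpB : ∀ v : UnitSphere d, ip v q ≤ θ →
      uniformSphere d {u | α ≤ ip u v ∧ h ≤ ip u q} ≤ pB)
    (v w : Fin n) (hv : v ≠ i) (hw : w ≠ i) (hvw : v ≠ w) :
    dataLaw d n i pstar (({x | x w ∈ targetRegion α t pstar q} ∩ {x | ip (x w) q ≤ θ}) ∩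
      ({x | α ≤ ip (x v) (x w)} ∩ {x | h ≤ ip (x v) q})) ≤
      pB * uniformSphere d (targetRegion α t pstar q) := by
  have := isProbabilityMeasure_pointLaw hd i pstar
  have hT := dataLaw_target_le α t i pstar q hd w hw
  rw [dataLaw_eq] at *
  refine (pi_inter_le (pointLaw i pstar) _ _
    ((measurableSet_target α t pstar q w).inter (measurableSet_low θ q w))
    ((measurableSet_adj α v w).inter (measurableSet_high h q v)) v pB ?_ ?_).trans ?_
  · intro x y
    simp only [Set.mem_inter_iff, Set.mem_ofPred_eq, Function.update_of_ne (Ne.symm hvw)]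
  · rintro x ⟨_, hx⟩
    rw [pointLaw_of_ne hv]
    simp only [Set.mem_inter_iff, Set.mem_ofPred_eq, Function.update_of_ne (Ne.symm hvw),
      Function.update_self]
    exact hpB _ hx
  · gcongr
    exact (measure_mono Set.inter_subset_left).trans hT

/-- The points are exposed in the order `w`, `v`, `u`. This bounds the target edges `(v, w)` spoiled
by a second high neighbor `u` of `v`. -/
theorem dataLaw_high_triple_le (hd : 1 ≤ d) (pN pB : ENNReal)
    (hpN : ∀ v : UnitSphere d, uniformSphere d {u | α ≤ ip u v} ≤ pN)
    (hpB : ∀ v : UnitSphere d, ip v q ≤ θ →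
      uniformSphere d {u | α ≤ ip u v ∧ h ≤ ip u q} ≤ pB)
    (v w u : Fin n) (hv : v ≠ i) (hw : w ≠ i) (hvw : v ≠ w) (hu : u ≠ i) (huv : u ≠ v)
    (huw : u ≠ w) :
    dataLaw d n i pstar ((({x | x w ∈ targetRegion α t pstar q} ∩ {x | α ≤ ip (x v) (x w)}) ∩
      {x | ip (x v) q ≤ θ}) ∩ ({x | α ≤ ip (x v) (x u)} ∩ {x | h ≤ ip (x u) q})) ≤
      pB * (pN * uniformSphere d (targetRegion α t pstar q)) := by
  have := isProbabilityMeasure_pointLaw hd i pstar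
  have hT := dataLaw_target_le α t i pstar q hd w hw
  rw [dataLaw_eq] at *
  refine (pi_inter_le (pointLaw i pstar) _ _
    (((measurableSet_target α t pstar q w).inter (measurableSet_adj α v w)).inter
      (measurableSet_low θ q v))
    ((measurableSet_adj α v u).inter (measurableSet_high h q u)) u pB ?_ ?_).trans ?_
  · intro x y
    simp only [Set.mem_inter_iff, Set.mem_ofPred_eq, Function.update_of_ne (Ne.symm huv),
      Function.update_of_ne (Ne.symm huw)]
  · rintro x ⟨_, hx⟩
    rw [pointLaw_of_ne hu]
    simp only [Set.mem_inter_iff, Set.mem_ofPred_eq, Function.update_of_ne (Ne.symm huv),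
      Function.update_self]
    refine (measure_mono ?_).trans (hpB _ hx)
    rintro y ⟨h1, h2⟩
    exact ⟨by rw [ip_comm]; exact h1, h2⟩
  · gcongr
    refine (measure_mono Set.inter_subset_left).trans ?_
    refine (pi_inter_le (pointLaw i pstar) _ _ (measurableSet_target α t pstar q w)
      (measurableSet_adj α v w) v pN ?_ ?_).trans ?_
    · intro x y
      simp only [Set.mem_ofPred_eq, Function.update_of_ne (Ne.symm hvw)]
    · intro x _
      rw [pointLaw_of_ne hv]
      simp only [Set.mem_ofPred_eq, Function.update_of_ne (Ne.symm hvw), Function.update_self]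
      exact hpN _
    · gcongr

theorem dataLaw_ne_pstar (hd : 1 ≤ d) : dataLaw d n i pstar {x | x i ≠ pstar} = 0 := by
  have := isProbabilityMeasure_pointLaw hd i pstar
  rw [dataLaw_eq]
  have hm : MeasurableSet {x : Fin n → UnitSphere d | x i ≠ pstar} := by
    have h1 : Measurable fun x : Fin n → UnitSphere d => x i := measurable_pi_apply i
    exact h1 (measurableSet_singleton pstar).compl
  have h := pi_inter_le (pointLaw i pstar) Set.univ {x | x i ≠ pstar} .univ hm i 0 (by simp)
    (fun x _ => by
      have : pointLaw i pstar i = Measure.dirac pstar := if_pos rfl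
      rw [this]
      simp only [Set.mem_ofPred_eq, Function.update_self]
      have hd := Measure.dirac_apply' pstar (measurableSet_singleton pstar).compl
      rw [Set.indicator_of_notMem (by simp)] at hd
      exact hd.le)
  simpa using h

open Classical in
theorem dataLaw_few_targets_le (hd : 1 ≤ d) (hn : 4 ≤ n) :
    dataLaw d n i pstar {x | (((Finset.univ \ {i}).filter
        fun w => x w ∈ targetRegion α t pstar q).card : ℝ) ≤
        n * (uniformSphere d).real (targetRegion α t pstar q) / 4} ≤
      ENNReal.ofReal (Real.exp
        (-(n * (uniformSphere d).real (targetRegion α t pstar q) / 16))) := by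
  have := isProbabilityMeasure_pointLaw hd i pstar
  rw [dataLaw_eq]
  set p := (uniformSphere d).real (targetRegion α t pstar q)
  have hp0 : 0 ≤ p := measureReal_nonneg
  have hcard : (n : ℝ) / 2 ≤ ((Finset.univ \ {i} : Finset (Fin n)).card : ℝ) := by
    rw [Finset.card_sdiff_of_subset (Finset.subset_univ _), Finset.card_univ, Fintype.card_fin,
      Finset.card_singleton, Nat.cast_sub (by omega)]
    have : (4 : ℝ) ≤ n := by exact_mod_cast hn
    push_cast; linarith
  have hcp := mul_le_mul_of_nonneg_right hcard hp0
  have h := pi_count_le_le (pointLaw i pstar) (fun w => {x | x w ∈ targetRegion α t pstar q})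
    (measurableSet_target α t pstar q) (Finset.univ \ {i}) p
    (fun j _ k _ hkj x y => by
      simp only [Set.mem_ofPred_eq, Function.update_of_ne (Ne.symm hkj)])
    (fun j hj x => by
      have hji : j ≠ i := by simpa using hj
      rw [pointLaw_of_ne hji]
      simp only [Set.mem_ofPred_eq, Function.update_self]
      exact le_rfl)
  refine (measure_mono fun x hx => ?_).trans (h.trans (ENNReal.ofReal_le_ofReal
    (Real.exp_le_exp.2 (by linarith))))
  simp only [Set.mem_ofPred_eq] at hx ⊢
  refine le_trans hx ?_
  linarith

open Classical in
theorem dataLaw_exists_low_degree_le (hd : 1 ≤ d) (hn : 4 ≤ n) (p : ℝ) (hp0 : 0 ≤ p)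
    (hp : ∀ v : UnitSphere d, p ≤ (uniformSphere d).real {u | α ≤ ip v u}) :
    dataLaw d n i pstar {x | ∃ w, (((Finset.univ \ {i, w}).filter
        fun v => α ≤ ip (x w) (x v)).card : ℝ) ≤ n * p / 4} ≤
      ENNReal.ofReal (n * Real.exp (-(n * p / 16))) := by
  have := isProbabilityMeasure_pointLaw hd i pstar
  rw [dataLaw_eq]
  have hsub : {x : Fin n → UnitSphere d | ∃ w, (((Finset.univ \ {i, w}).filter
        fun v => α ≤ ip (x w) (x v)).card : ℝ) ≤ n * p / 4} ⊆
      ⋃ w : Fin n, {x | (((Finset.univ \ {i, w}).filter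
        fun v => α ≤ ip (x w) (x v)).card : ℝ) ≤ n * p / 4} := by
    rintro x ⟨w, hw⟩
    exact Set.mem_iUnion.2 ⟨w, hw⟩
  refine (measure_mono hsub).trans ((measure_iUnion_fintype_le _ _).trans ?_)
  calc _ ≤ ∑ _w : Fin n, ENNReal.ofReal (Real.exp (-(n * p / 16))) := by
        refine Finset.sum_le_sum fun w _ => ?_
        have hcard : (n : ℝ) / 2 ≤ ((Finset.univ \ {i, w} : Finset (Fin n)).card : ℝ) := by
          have h2 : ({i, w} : Finset (Fin n)).card ≤ 2 := Finset.card_le_two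
          rw [Finset.card_sdiff_of_subset (Finset.subset_univ _), Finset.card_univ,
            Fintype.card_fin, Nat.cast_sub (by omega)]
          have : (4 : ℝ) ≤ n := by exact_mod_cast hn
          have : (({i, w} : Finset (Fin n)).card : ℝ) ≤ 2 := by exact_mod_cast h2
          linarith
        have hcp := mul_le_mul_of_nonneg_right hcard hp0
        have h := pi_count_le_le (pointLaw i pstar) (fun v => {x | α ≤ ip (x w) (x v)})
          (measurableSet_adj α w) (Finset.univ \ {i, w}) p
          (fun j hj k hk hkj x y => by
            simp only [Finset.mem_sdiff, Finset.mem_univ, true_and, Finset.mem_insert,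
              Finset.mem_singleton, not_or] at hj hk
            simp only [Set.mem_ofPred_eq, Function.update_of_ne (Ne.symm hk.2),
              Function.update_of_ne (Ne.symm hkj)])
          (fun j hj x => by
            simp only [Finset.mem_sdiff, Finset.mem_univ, true_and, Finset.mem_insert,
              Finset.mem_singleton, not_or] at hj
            rw [pointLaw_of_ne hj.1]
            simp only [Set.mem_ofPred_eq, Function.update_of_ne (Ne.symm hj.2),
              Function.update_self]
            exact hp _)
        refine (measure_mono fun x hx => ?_).trans (h.trans (ENNReal.ofReal_le_ofReal
          (Real.exp_le_exp.2 (by linarith))))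
        simp only [Set.mem_ofPred_eq] at hx ⊢
        refine le_trans hx ?_
        linarith
    _ = _ := by
      rw [Finset.sum_const, Finset.card_univ, Fintype.card_fin, nsmul_eq_mul,
        ENNReal.ofReal_mul (Nat.cast_nonneg n), ENNReal.ofReal_natCast]

end RelayData

open Classical in
-- Chernoff bounds give at least `n pT / 4` targets and degrees at least `n pN / 4`, hence `4c`
-- target edges with `c = n² pT pN / 64`. Markov's inequality leaves fewer than `c` edges in each of
-- the two bad classes `E2` and `E3`, so at least `2c` relay starts remain. The factor `pT` cancels
-- in the Markov bounds, which is why they only compare `pB` with `pN`.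
theorem exists_rare_set_relay {d n : ℕ} (hd : 1 ≤ d) (hn : 4 ≤ n) (i : Fin n)
    (pstar q : UnitSphere d) (α h t θ k pN pB : ℝ) (hα : 0 ≤ α) (hα2 : α ^ 2 ≤ 1 / 2)
    (hθ : 0 ≤ θ) (hθ2 : θ ^ 2 ≤ 1 / 2) (hht : h ≤ t) (hpN0 : 0 < pN) (hpB0 : 0 ≤ pB)
    (hpT : 0 < (uniformSphere d).real (targetRegion α t pstar q))
    (hpN : ∀ v : UnitSphere d, pN ≤ (uniformSphere d).real {u | α ≤ ip v u})
    (hpB : ∀ v : UnitSphere d, ip v q ≤ θ →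
      uniformSphere d {u | α ≤ ip u v ∧ h ≤ ip u q} ≤ ENNReal.ofReal pB) :
    ∃ B : Set (Fin n → UnitSphere d),
      dataLaw d n i pstar B ≤ ENNReal.ofReal (n * Real.exp (-(d * θ ^ 2 / 2)) +
        n * Real.exp (2 * (n * Real.exp (-(d * α ^ 2 / 2))) - k) +
        Real.exp (-(n * (uniformSphere d).real (targetRegion α t pstar q) / 16)) +
        n * Real.exp (-(n * pN / 16)) +
        (64 * pB / pN + 64 * (n * pB * Real.exp (-(d * α ^ 2 / 2))) / pN)) ∧
      ∀ x ∉ B, x i = pstar ∧ (∀ j, j ≠ i → ip (x j) q ≤ θ) ∧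
        (∀ v, ((bucket α x v).length : ℝ) ≤ 1 + k) ∧
        n ^ 2 * ((uniformSphere d).real (targetRegion α t pstar q) * pN) / 32 ≤
          ((Finset.univ.filter fun v => x ∈ relaySet α h t i pstar q v).card : ℝ) := by
  have := isProbabilityMeasure_uniformSphere hd
  have := isProbabilityMeasure_dataLaw hd i pstar
  set pT := (uniformSphere d).real (targetRegion α t pstar q) with hpTdef
  have hpTe : uniformSphere d (targetRegion α t pstar q) = ENNReal.ofReal pT :=
    (ofReal_measureReal).symm
  set N1 := Real.exp (-(d * α ^ 2 / 2)) with hN1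
  have hN10 : 0 ≤ N1 := (Real.exp_pos _).le
  have hn0 : (0 : ℝ) < n := by exact_mod_cast (by omega : 0 < n)
  set c : ℝ := n ^ 2 * (pT * pN) / 64 with hc
  have hc0 : 0 < c := by positivity
  let TE : Fin n × Fin n → (Fin n → UnitSphere d) → Prop := fun p x =>
    IsTargetEdge (fun v w => α ≤ ip (x v) (x w)) (fun w => x w ∈ targetRegion α t pstar q) i p
  let E2 : Fin n × Fin n → Set (Fin n → UnitSphere d) := fun p =>
    {x | TE p x} ∩ ({x | h ≤ ip (x p.1) q} ∩ {x | ip (x p.2) q ≤ θ})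
  let E3 : (Fin n × Fin n) × Fin n → Set (Fin n → UnitSphere d) := fun s =>
    {x | TE s.1 x} ∩ ({_x | s.2 ≠ i ∧ s.2 ≠ s.1.1 ∧ s.2 ≠ s.1.2} ∩
      ({x | α ≤ ip (x s.1.1) (x s.2)} ∩ ({x | h ≤ ip (x s.2) q} ∩ {x | ip (x s.1.1) q ≤ θ})))
  have hE2 : ∀ p, MeasurableSet (E2 p) := fun p => (measurableSet_targetEdge α t i pstar q p).inter
    ((measurableSet_high h q _).inter (measurableSet_low θ q _))
  have hE3 : ∀ s, MeasurableSet (E3 s) := fun s =>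
    (measurableSet_targetEdge α t i pstar q s.1).inter ((MeasurableSet.const _).inter
      ((measurableSet_adj α _ _).inter
        ((measurableSet_high h q _).inter (measurableSet_low θ q _))))
  have hE2p : ∀ p, dataLaw d n i pstar (E2 p) ≤ ENNReal.ofReal (pB * pT) := by
    rintro ⟨v, w⟩
    by_cases hvw : v ≠ i ∧ w ≠ i ∧ v ≠ w
    · rw [ENNReal.ofReal_mul hpB0, ← hpTe]
      refine (measure_mono ?_).trans (dataLaw_high_pair_le α h t θ i pstar q hd _ hpB v w hvw.1
        hvw.2.1 hvw.2.2)
      rintro x ⟨⟨_, _, _, h4, h5⟩, h6, h7⟩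
      exact ⟨⟨h4, h7⟩, h5, h6⟩
    · have : E2 (v, w) = ∅ := by
        refine Set.eq_empty_iff_forall_notMem.2 ?_
        rintro x ⟨⟨h1, h2, h3, _⟩, _⟩
        exact hvw ⟨h1, h2, h3⟩
      simp [this]
  have hcapN : ∀ v : UnitSphere d, uniformSphere d {u | α ≤ ip u v} ≤ ENNReal.ofReal N1 :=
    fun v => uniformSphere_cap_le hd v (by simp) α hα hα2
  have hE3p : ∀ s, dataLaw d n i pstar (E3 s) ≤ ENNReal.ofReal (pB * (N1 * pT)) := by
    rintro ⟨⟨v, w⟩, u⟩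
    by_cases hvw : (v ≠ i ∧ w ≠ i ∧ v ≠ w) ∧ u ≠ i ∧ u ≠ v ∧ u ≠ w
    · rw [ENNReal.ofReal_mul hpB0, ENNReal.ofReal_mul hN10, ← hpTe]
      refine (measure_mono ?_).trans (dataLaw_high_triple_le α h t θ i pstar q hd _ _ hcapN hpB v w
        u hvw.1.1 hvw.1.2.1 hvw.1.2.2 hvw.2.1 hvw.2.2.1 hvw.2.2.2)
      rintro x ⟨⟨_, _, _, h4, h5⟩, _, h6, h7, h8⟩
      exact ⟨⟨⟨h4, h5⟩, h8⟩, h6, h7⟩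
    · have : E3 ((v, w), u) = ∅ := by
        refine Set.eq_empty_iff_forall_notMem.2 ?_
        rintro x ⟨⟨h1, h2, h3, _⟩, h4, _⟩
        exact hvw ⟨⟨h1, h2, h3⟩, h4⟩
      simp [this]
  have m2 := measure_count_ge_le (dataLaw d n i pstar) E2 hE2 (pB * pT) c hc0 hE2p
  have m3 := measure_count_ge_le (dataLaw d n i pstar) E3 hE3 (pB * (N1 * pT)) c hc0 hE3p
  have m1 := dataLaw_exists_far_le hd i pstar q θ hθ hθ2
  have m4 := dataLaw_exists_bucket_gt_le hd i pstar α hα hα2 k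
  have m5 := dataLaw_few_targets_le α t i pstar q hd hn
  have m6 := dataLaw_exists_low_degree_le α i pstar hd hn pN hpN0.le hpN
  have m0 := dataLaw_ne_pstar i pstar hd
  have e2 : (Fintype.card (Fin n × Fin n) : ℝ) * (pB * pT) / c = 64 * pB / pN := by
    rw [hc, Fintype.card_prod, Fintype.card_fin]
    push_cast
    field_simp
  have e3 : (Fintype.card ((Fin n × Fin n) × Fin n) : ℝ) * (pB * (N1 * pT)) / c =
      64 * (n * pB * N1) / pN := by
    rw [hc, Fintype.card_prod, Fintype.card_prod, Fintype.card_fin]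
    push_cast
    field_simp
  rw [e2] at m2
  rw [e3] at m3
  refine ⟨{x | x i ≠ pstar} ∪ ({x | ∃ j, j ≠ i ∧ θ < ip (x j) q} ∪
    {x | ∃ v, 1 + k < (bucket α x v).length} ∪ {x | (((Finset.univ \ {i}).filter
        fun w => x w ∈ targetRegion α t pstar q).card : ℝ) ≤ n * pT / 4} ∪
    {x | ∃ w, (((Finset.univ \ {i, w}).filter
        fun v => α ≤ ip (x w) (x v)).card : ℝ) ≤ n * pN / 4} ∪
    ({x | c ≤ ((Finset.univ.filter fun k => x ∈ E2 k).card : ℝ)} ∪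
      {x | c ≤ ((Finset.univ.filter fun k => x ∈ E3 k).card : ℝ)})), ?_, ?_⟩
  · refine (measure_union_le _ _).trans ?_
    rw [m0, zero_add, ENNReal.ofReal_add (by positivity) (by positivity),
      ENNReal.ofReal_add (by positivity) (by positivity),
      ENNReal.ofReal_add (by positivity) (by positivity),
      ENNReal.ofReal_add (by positivity) (by positivity),
      ENNReal.ofReal_add (p := 64 * pB / pN) (by positivity) (by positivity)]
    refine (measure_union_le _ _).trans (add_le_add ?_
      ((measure_union_le _ _).trans (add_le_add (le_of_eq_of_le (by congr!) m2)
        (le_of_eq_of_le (by congr!) m3))))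
    refine (measure_union_le _ _).trans (add_le_add ?_ m6)
    refine (measure_union_le _ _).trans (add_le_add ?_ m5)
    exact (measure_union_le _ _).trans (add_le_add m1 m4)
  · intro x hx
    simp only [Set.mem_union, Set.mem_ofPred_eq, not_or, not_exists, not_and, not_lt, not_le,
      ne_eq, not_not] at hx
    obtain ⟨h0, ⟨⟨⟨h1, h4⟩, h5⟩, h6⟩, h2, h3⟩ := hx
    refine ⟨h0, h1, h4, ?_⟩
    have hge := card_targetEdge_ge (fun v w => α ≤ ip (x v) (x w))
      (fun w => x w ∈ targetRegion α t pstar q) i (fun v w => by rw [ip_comm])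
      (n * pT / 4) (n * pN / 4) (by positivity) h5.le (fun w => (h6 w).le)
    have hle := card_targetEdge_le (fun v w => α ≤ ip (x v) (x w))
      (fun w => x w ∈ targetRegion α t pstar q) (fun w => h ≤ ip (x w) q) i
      (fun v hv => hht.trans hv.1)
    have hle' : (Finset.univ.filter fun p : Fin n × Fin n => TE p x).card ≤
        (Finset.univ.filter fun v => x ∈ relaySet α h t i pstar q v).card +
        (Finset.univ.filter fun k => x ∈ E2 k).card +
        (Finset.univ.filter fun k => x ∈ E3 k).card := by
      refine hle.trans (add_le_add_three le_rfl (Finset.card_le_card fun p hp => ?_)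
        (Finset.card_le_card fun s hs => ?_))
      · simp only [Finset.mem_filter, Finset.mem_univ, true_and] at hp ⊢
        exact ⟨hp.1, hp.2, h1 _ hp.1.2.1⟩
      · simp only [Finset.mem_filter, Finset.mem_univ, true_and] at hs ⊢
        exact ⟨hs.1, ⟨hs.2.1, hs.2.2.1, hs.2.2.2.1⟩, hs.2.2.2.2.1, hs.2.2.2.2.2, h1 _ hs.1.1⟩
    have hle'' : ((Finset.univ.filter fun p : Fin n × Fin n => TE p x).card : ℝ) ≤
        (Finset.univ.filter fun v => x ∈ relaySet α h t i pstar q v).card +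
        (Finset.univ.filter fun k => x ∈ E2 k).card +
        (Finset.univ.filter fun k => x ∈ E3 k).card := by exact_mod_cast hle'
    have hfin : (n * pT / 4) * (n * pN / 4) = 4 * c := by rw [hc]; ring
    have hfin2 : n ^ 2 * (pT * pN) / 32 = 2 * c := by rw [hc]; ring
    rw [hfin] at hge
    rw [hfin2]
    have hge' : 4 * c ≤ ((Finset.univ.filter fun p : Fin n × Fin n => TE p x).card : ℝ) := hge
    linarith

/-! ### Asymptotics -/

/-- The error terms in the exponent of the quadrant bound: `√d ‖u‖` has order `√ℓ`, and `d x²` with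
`x = ‖u‖² + 6‖u‖/√d` has order `ℓ s² + s²`. The remaining `3` absorbs the factor `8`. All of this is
below `τ ℓ` once `ℓ` is large and `s` small. -/
theorem quadrant_exponent_le (D l τ U s w : ℝ) (hτ : 0 < τ) (hl : 0 ≤ l) (hU0 : 0 ≤ U)
    (hs0 : 0 ≤ s) (hs : s ≤ 1 / 50) (hs2 : s ^ 2 ≤ τ / 256) (hl1 : 12 ≤ τ * l)
    (hl2 : 1152 ≤ τ ^ 2 * l) (hw : w ^ 2 = D) (hw1 : 1 ≤ w) (hds : D * s ^ 2 = 2 * l)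
    (hu : U ≤ 2 * s) :
    U ^ 2 + 6 * U / w ≤ 1 / 2 ∧ 3 * (w * U) + D * (U ^ 2 + 6 * U / w) ^ 2 + 3 ≤ τ * l := by
  have hxU : 6 * U / w ≤ 6 * U := div_le_self (by positivity) hw1
  have hD0 : 0 ≤ D := hw ▸ sq_nonneg w
  have hUs : U ^ 2 ≤ 4 * s ^ 2 := by
    calc U ^ 2 ≤ (2 * s) ^ 2 := by gcongr
      _ = 4 * s ^ 2 := by ring
  have hs3 : s ^ 2 ≤ (1 / 50) ^ 2 := by gcongr
  have h4 : D * U ^ 2 ≤ 8 * l := by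
    calc D * U ^ 2 ≤ D * (4 * s ^ 2) := by gcongr
      _ = 8 * l := by linear_combination 4 * hds
  refine ⟨by linarith, ?_⟩
  have hwU : w * U ≤ τ / 12 * l := by
    refine abs_le_of_sq_le_sq' ?_ (by positivity) |>.2
    have h1 : (w * U) ^ 2 ≤ 8 * l := by rw [mul_pow, hw]; exact h4
    have h2 := mul_le_mul_of_nonneg_right hl2 hl
    have h3 : (τ / 12 * l) ^ 2 = τ ^ 2 * l * l / 144 := by ring
    rw [h3]; linarith
  have h1 : w * (U ^ 2 + 6 * U / w) = w * U ^ 2 + 6 * U := by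
    field_simp
  have h2 : D * (U ^ 2 + 6 * U / w) ^ 2 = (w * U ^ 2 + 6 * U) ^ 2 := by rw [← h1, mul_pow, hw]
  have h3 : (w * U ^ 2 + 6 * U) ^ 2 ≤ 2 * (D * U ^ 2 * U ^ 2) + 72 * U ^ 2 := by
    have h5 := sq_nonneg (w * U ^ 2 - 6 * U)
    have h6 : (w * U ^ 2 + 6 * U) ^ 2 + (w * U ^ 2 - 6 * U) ^ 2 =
        2 * (w ^ 2 * U ^ 2 * U ^ 2) + 72 * U ^ 2 := by ring
    rw [hw] at h6; linarith
  have h5 : D * U ^ 2 * U ^ 2 ≤ 8 * l * (4 * (τ / 256)) := by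
    gcongr
    linarith
  rw [h2]
  linarith

/-- The scale `√(2 ℓ / d)` of the largest of `e ^ ℓ` dot products of random unit vectors. -/
noncomputable def dotScale (ℓ : ℕ → ℝ) (d : ℕ) : ℝ := Real.sqrt (2 * ℓ d / d)

/-- `ℓ = log n` for a data set of `n` points with `n = 2 ^ o(d)` and `d = n ^ o(1)`. -/
structure SparseRegime (ℓ : ℕ → ℝ) : Prop where
  isLittleO_dim : ℓ =o[atTop] (fun d : ℕ => (d : ℝ))
  log_isLittleO : (fun d : ℕ => Real.log d) =o[atTop] ℓ
  nonneg : ∀ d, 0 ≤ ℓ d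

namespace SparseRegime

variable {ℓ : ℕ → ℝ}

theorem eventually_log_le (hℓ : SparseRegime ℓ) {κ : ℝ} (hκ : 0 < κ) :
    ∀ᶠ d : ℕ in atTop, Real.log d ≤ κ * ℓ d := by
  filter_upwards [hℓ.log_isLittleO.bound hκ] with d h
  rw [Real.norm_of_nonneg (hℓ.nonneg d)] at h
  exact (le_abs_self _).trans h

theorem eventually_ge (hℓ : SparseRegime ℓ) (C : ℝ) : ∀ᶠ d in atTop, C ≤ ℓ d := by
  have h1 : Tendsto (fun d : ℕ => Real.log d) atTop atTop :=
    Real.tendsto_log_atTop.comp tendsto_natCast_atTop_atTop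
  filter_upwards [h1.eventually_ge_atTop C, hℓ.eventually_log_le one_pos] with d h2 h3
  linarith

theorem eventually_le_dim (hℓ : SparseRegime ℓ) {κ : ℝ} (hκ : 0 < κ) :
    ∀ᶠ d : ℕ in atTop, ℓ d ≤ κ * d := by
  filter_upwards [hℓ.isLittleO_dim.bound hκ] with d h
  simpa using (le_abs_self _).trans h

theorem eventually_dim_le (hℓ : SparseRegime ℓ) {κ : ℝ} (hκ : 0 < κ) :
    ∀ᶠ d : ℕ in atTop, (d : ℝ) ≤ Real.exp (κ * ℓ d) := by
  filter_upwards [hℓ.eventually_log_le hκ, eventually_ge_atTop 1] with d h hd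
  have hd0 : (0 : ℝ) < d := by exact_mod_cast hd
  rw [← Real.exp_log hd0]
  exact Real.exp_le_exp.2 h

theorem eventually_le_exp (hℓ : SparseRegime ℓ) {κ : ℝ} (hκ : 0 < κ) (A B : ℝ) :
    ∀ᶠ d : ℕ in atTop, A * ℓ d + B ≤ Real.exp (κ * ℓ d) := by
  filter_upwards [hℓ.eventually_ge 1, hℓ.eventually_ge (2 / κ ^ 2 * (|A| + |B|))] with d h1 h2
  have h3 := Real.quadratic_le_exp_of_nonneg (x := κ * ℓ d) (by nlinarith)
  have h4 : |A| + |B| ≤ κ ^ 2 / 2 * ℓ d := by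
    rw [div_mul_eq_mul_div, div_le_iff₀ (by positivity)] at h2
    linarith
  nlinarith [le_abs_self A, le_abs_self B, abs_nonneg B, mul_le_mul_of_nonneg_right h4
    (by linarith : (0 : ℝ) ≤ ℓ d)]

theorem dotScale_sq (hℓ : SparseRegime ℓ) (d : ℕ) : dotScale ℓ d ^ 2 = 2 * ℓ d / d :=
  Real.sq_sqrt (div_nonneg (by linarith [hℓ.nonneg d]) (Nat.cast_nonneg d))

theorem dim_mul_dotScale_sq (hℓ : SparseRegime ℓ) {d : ℕ} (hd : 0 < d) :
    d * dotScale ℓ d ^ 2 = 2 * ℓ d := by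
  rw [hℓ.dotScale_sq, mul_div_cancel₀]
  exact_mod_cast hd.ne'

theorem eventually_dotScale_pos (hℓ : SparseRegime ℓ) : ∀ᶠ d : ℕ in atTop, 0 < dotScale ℓ d := by
  filter_upwards [hℓ.eventually_ge 1, eventually_ge_atTop 1] with d h1 hd
  have hd0 : (0 : ℝ) < d := by exact_mod_cast hd
  exact Real.sqrt_pos.2 (by positivity)

theorem eventually_dotScale_le (hℓ : SparseRegime ℓ) {κ : ℝ} (hκ : 0 < κ) :
    ∀ᶠ d : ℕ in atTop, dotScale ℓ d ≤ κ := by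
  filter_upwards [hℓ.eventually_le_dim (κ := κ ^ 2 / 2) (by positivity),
    eventually_ge_atTop 1] with d h1 hd
  have hd0 : (0 : ℝ) < d := by exact_mod_cast hd
  refine Real.sqrt_le_iff.2 ⟨hκ.le, ?_⟩
  rw [div_le_iff₀ hd0]
  linarith

theorem eventually_one_div_le (hℓ : SparseRegime ℓ) {κ : ℝ} (hκ : 0 < κ) :
    ∀ᶠ d : ℕ in atTop, 1 / (d : ℝ) ≤ κ * dotScale ℓ d := by
  filter_upwards [hℓ.eventually_ge (1 / κ ^ 2), eventually_ge_atTop 1] with d h1 hd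
  have hd1 : (1 : ℝ) ≤ d := by exact_mod_cast hd
  have h2 := hℓ.dotScale_sq d
  have h3 : 0 ≤ dotScale ℓ d := Real.sqrt_nonneg _
  refine abs_le_of_sq_le_sq' ?_ (by positivity) |>.2
  rw [mul_pow, h2, div_pow, one_pow, mul_div_assoc', div_le_div_iff₀ (by positivity)
    (by positivity)]
  rw [div_le_iff₀ (by positivity)] at h1
  nlinarith [mul_le_mul_of_nonneg_right h1 (by positivity : (0 : ℝ) ≤ d)]

/-- The large-deviation lower bound at scale `s`, uniform in the angle between `p` and `q`: the cost
is that of shifting a standard Gaussian by `√d u`. -/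
theorem eventually_quadrant_ge (hℓ : SparseRegime ℓ) {τ : ℝ} (hτ : 0 < τ) :
    ∀ᶠ d : ℕ in atTop, ∀ (p q : UnitSphere d) (u : EuclideanSpace ℝ (Fin d)), 0 ≤ ip p q →
      0 ≤ inner ℝ u (p : EuclideanSpace ℝ (Fin d)) → 0 ≤ inner ℝ u (q : EuclideanSpace ℝ (Fin d)) →
      ‖u‖ ≤ 2 * dotScale ℓ d →
      Real.exp (-(d * ‖u‖ ^ 2 / 2 + τ * ℓ d)) ≤ (uniformSphere d).real
        {x | inner ℝ u (p : EuclideanSpace ℝ (Fin d)) ≤ inner ℝ (x : EuclideanSpace ℝ (Fin d)) p ∧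
          inner ℝ u (q : EuclideanSpace ℝ (Fin d)) ≤
            inner ℝ (x : EuclideanSpace ℝ (Fin d)) q} := by
  filter_upwards [hℓ.eventually_dotScale_le (κ := 1 / 50) (by norm_num),
    hℓ.eventually_dotScale_le (κ := Real.sqrt (τ / 256)) (by positivity),
    hℓ.eventually_ge (12 / τ), hℓ.eventually_ge (1152 / τ ^ 2), eventually_ge_atTop 18]
    with d hs hs2 hl1 hl2 hd p q u hpq hup huq hu
  have hd0 : 0 < d := by omega
  have hd1 : (1 : ℝ) ≤ d := by exact_mod_cast hd0
  have hs2' : dotScale ℓ d ^ 2 ≤ τ / 256 := by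
    rw [← Real.sq_sqrt (by positivity : 0 ≤ τ / 256)]
    exact pow_le_pow_left₀ (Real.sqrt_nonneg _) hs2 2
  have hw1 : 1 ≤ Real.sqrt d := Real.one_le_sqrt.2 hd1
  have hww : Real.sqrt d ^ 2 = d := Real.sq_sqrt (by linarith)
  rw [div_le_iff₀ hτ, mul_comm] at hl1
  rw [div_le_iff₀ (by positivity), mul_comm] at hl2
  obtain ⟨hx2, hexp⟩ := quadrant_exponent_le d (ℓ d) τ ‖u‖ (dotScale ℓ d) (Real.sqrt d) hτ
    (hℓ.nonneg d) (norm_nonneg u) (Real.sqrt_nonneg _) hs hs2' hl1 hl2 hww hw1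
    (hℓ.dim_mul_dotScale_sq hd0) hu
  obtain ⟨x, hx⟩ : ∃ x, x = ‖u‖ ^ 2 + 6 * ‖u‖ / Real.sqrt d := ⟨_, rfl⟩
  have hx0 : 0 ≤ x := by rw [hx]; positivity
  rw [← hx] at hx2 hexp
  -- For `x ≤ 1/2`, `exp (-(x + 2x²)) ≤ 1 - x`; this `R` is admissible and makes `R ^ d` an explicit
  -- exponential.
  obtain ⟨R, hR⟩ : ∃ R, R = Real.exp (-(x + 2 * x ^ 2) / 2) := ⟨_, rfl⟩
  have hR2 : R ^ 2 + ‖u‖ ^ 2 + 6 * ‖u‖ / Real.sqrt d ≤ 1 := by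
    have h1 : R ^ 2 = Real.exp (-(x + 2 * x ^ 2)) := by
      rw [hR, ← Real.exp_nat_mul]; congr 1; push_cast; ring
    have h2 : Real.exp (-(x + 2 * x ^ 2)) ≤ 1 - x := by
      rw [← Real.le_log_iff_exp_le (by linarith)]
      have h3 := Real.one_sub_inv_le_log_of_pos (by linarith : 0 < 1 - x)
      have h4 : (1 - x)⁻¹ ≤ 1 + x + 2 * x ^ 2 := by
        rw [inv_le_iff_one_le_mul₀ (by linarith)]
        have h5 : (1 + x + 2 * x ^ 2) * (1 - x) = 1 + 2 * (x ^ 2 * (1 / 2 - x)) := by ring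
        have h6 := mul_nonneg (sq_nonneg x) (sub_nonneg.2 hx2)
        linarith
      linarith
    rw [h1]; linarith
  have h := uniformSphere_quadrant_ge hd (p : EuclideanSpace ℝ (Fin d)) q u (by simp) (by simp) hpq
    hup huq R (hR ▸ Real.exp_pos _) hR2
  have := isProbabilityMeasure_uniformSphere (by omega : 1 ≤ d)
  refine le_trans ?_ ((ENNReal.ofReal_le_iff_le_toReal (measure_ne_top _ _)).1 h)
  have hRd : R ^ d =
      Real.exp (-(d * ‖u‖ ^ 2 / 2 + 3 * (Real.sqrt d * ‖u‖) + d * x ^ 2)) := by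
    rw [hR, ← Real.exp_nat_mul]
    congr 1
    have h1 : Real.sqrt d ^ 2 * x =
        Real.sqrt d ^ 2 * ‖u‖ ^ 2 + 6 * (Real.sqrt d * ‖u‖) := by
      rw [hx]; field_simp
    rw [hww] at h1
    linear_combination (-1 / 2 : ℝ) * h1
  have hexp3 : (8 : ℝ) ≤ Real.exp 3 := by
    have h1 : (2 : ℝ) ≤ Real.exp 1 := by linarith [Real.add_one_le_exp (1 : ℝ)]
    calc (8 : ℝ) = 2 ^ 3 := by norm_num
      _ ≤ Real.exp 1 ^ 3 := by gcongr
      _ = Real.exp 3 := by rw [← Real.exp_nat_mul]; norm_num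
  rw [hRd, le_div_iff₀ (by norm_num)]
  calc _ ≤ Real.exp (-(d * ‖u‖ ^ 2 / 2 + τ * ℓ d)) * Real.exp 3 := by gcongr
    _ = Real.exp (-(d * ‖u‖ ^ 2 / 2 + τ * ℓ d) + 3) := (Real.exp_add _ _).symm
    _ ≤ _ := Real.exp_le_exp.2 (by linarith)

end SparseRegime

/-! ### Short vectors with prescribed dot products -/

/-- For `k = a b` and `a² + b² = 1` the quotient is the squared norm of the vector in the span of
`p`, `q` with dot products `a`, `b`, at angle cosine `g`. Its derivative in `g` has the sign of `g -
k (1 + g²)`. A planted point closer to `q` than required thus only helps. -/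
theorem short_norm_antitone (k g γ : ℝ) (hg : 0 ≤ g) (hγ1 : γ < 1) (hgγ : g ≤ γ)
    (hk : γ ≤ k * (1 + γ ^ 2)) :
    (1 - 2 * γ * k) / (1 - γ ^ 2) ≤ (1 - 2 * g * k) / (1 - g ^ 2) := by
  have hγ0 : 0 ≤ γ := hg.trans hgγ
  have hγ2 : 0 < 1 - γ ^ 2 := by nlinarith
  have hg2 : 0 < 1 - g ^ 2 := by nlinarith
  rw [div_le_div_iff₀ hγ2 hg2]
  have h3 : γ + g ≤ 2 * k * (1 + γ * g) := by
    have h4 : 2 * γ * (1 + γ * g) - (γ + g) * (1 + γ ^ 2) = (γ - g) * (1 - γ ^ 2) := by ring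
    have h5 := mul_nonneg (sub_nonneg.2 hgγ) hγ2.le
    have h6 := mul_le_mul_of_nonneg_right hk (by positivity : 0 ≤ 2 * (1 + γ * g))
    have h7 : 0 < 1 + γ ^ 2 := by positivity
    refine le_of_mul_le_mul_right ?_ h7
    linarith
  have h8 := mul_le_mul_of_nonneg_left h3 (sub_nonneg.2 hgγ)
  linarith

/-- A short vector with prescribed dot products, uniformly in the angle between `p` and `q`. -/
theorem exists_short_vector {F : Type*} [NormedAddCommGroup F] [InnerProductSpace ℝ F] (p q : F)
    (hp : ‖p‖ = 1) (hq : ‖q‖ = 1) (a b g η s : ℝ) (ha : 0 < a) (hb : 0 < b)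
    (hab : a ^ 2 + b ^ 2 = 1) (hg : 0 ≤ g) (hg1 : g < 1) (hgpq : g ≤ inner ℝ p q)
    (hba : b ≤ a) (hη : 0 ≤ η) (hη1 : η ≤ 1) (hs : 0 ≤ s) :
    ∃ u : F, a * s ≤ inner ℝ u p ∧ (b + η) * s ≤ inner ℝ u q ∧
      ‖u‖ ^ 2 ≤ ((1 - 2 * g * (a * b)) / (1 - g ^ 2) + 3 * η) * s ^ 2 := by
  set γ := inner ℝ p q with hγ
  have hγ1 : γ ≤ 1 := by
    have := real_inner_le_norm p q
    rwa [hp, hq, one_mul] at this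
  have hqp : inner ℝ q p = γ := real_inner_comm p q
  have ha1 : a ≤ 1 := by nlinarith
  have hb1 : b ≤ 1 := by nlinarith
  have hg2 : 0 < 1 - g ^ 2 := by nlinarith
  have hpp : inner ℝ p p = (1 : ℝ) := by rw [real_inner_self_eq_norm_sq, hp]; norm_num
  have hqq : inner ℝ q q = (1 : ℝ) := by rw [real_inner_self_eq_norm_sq, hq]; norm_num
  have hbase : ∃ x y : ℝ, a ≤ x + y * γ ∧ b + η ≤ x * γ + y ∧
      x ^ 2 + 2 * x * y * γ + y ^ 2 ≤ (1 - 2 * g * (a * b)) / (1 - g ^ 2) + 3 * η := by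
    -- If `b ≤ γ a`, the multiple `a p` already meets the second constraint and only `η q` is added.
    -- Otherwise `x`, `y` solve the Gram system for `(a, b)`. In both cases the extra `η` costs at
    -- most `2η + η² ≤ 3η`.
    rcases le_or_gt b (γ * a) with h | h
    · refine ⟨a, η, by nlinarith, by nlinarith, ?_⟩
      have h1 : a ^ 2 ≤ (1 - 2 * g * (a * b)) / (1 - g ^ 2) := by
        rw [le_div_iff₀ hg2]
        nlinarith [sq_nonneg (b - g * a)]
      have h2 : a * η * γ ≤ η := by
        calc a * η * γ ≤ 1 * η * 1 := by gcongr; linarith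
          _ = η := by ring
      nlinarith
    · have hγlt : γ < 1 := by nlinarith
      have hγ2 : 0 < 1 - γ ^ 2 := by nlinarith
      have hγ0 : 0 ≤ γ := hg.trans hgpq
      have e1 : (a - γ * b) / (1 - γ ^ 2) + (b - γ * a) / (1 - γ ^ 2) * γ = a := by
        field_simp; ring
      have e2 : (a - γ * b) / (1 - γ ^ 2) * γ + (b - γ * a) / (1 - γ ^ 2) = b := by
        field_simp; ring
      set x := (a - γ * b) / (1 - γ ^ 2)
      set y := (b - γ * a) / (1 - γ ^ 2)
      have e3 : x * a + y * b = (1 - 2 * γ * (a * b)) / (1 - γ ^ 2) := by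
        simp only [x, y]
        rw [← hab]
        field_simp; ring
      refine ⟨x, y + η, by nlinarith, by nlinarith, ?_⟩
      have h1 : (1 - 2 * γ * (a * b)) / (1 - γ ^ 2) ≤ (1 - 2 * g * (a * b)) / (1 - g ^ 2) := by
        refine short_norm_antitone (a * b) g γ hg hγlt hgpq ?_
        have h3 : γ * b ≤ a := by nlinarith
        have h4 : a * b * (1 + γ ^ 2) - γ * (a ^ 2 + b ^ 2) = (b - γ * a) * (a - γ * b) := by ring
        have h5 := mul_nonneg (sub_nonneg.2 h.le) (sub_nonneg.2 h3)
        rw [hab] at h4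
        linarith
      have h2 : x ^ 2 + 2 * x * (y + η) * γ + (y + η) ^ 2 =
          (x * (x + y * γ) + y * (x * γ + y)) + 2 * η * (x * γ + y) + η ^ 2 := by ring
      rw [h2, e1, e2, e3]
      nlinarith
  obtain ⟨x, y, h1, h2, h3⟩ := hbase
  refine ⟨s • (x • p + y • q), ?_, ?_, ?_⟩
  · rw [inner_smul_left, inner_add_left, inner_smul_left, inner_smul_left, hpp, hqp]
    simp only [conj_trivial, mul_one]
    rw [mul_comm]; gcongr
  · rw [inner_smul_left, inner_add_left, inner_smul_left, inner_smul_left, hqq, ← hγ]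
    simp only [conj_trivial, mul_one]
    rw [mul_comm]; gcongr
  · have h4 : ‖x • p + y • q‖ ^ 2 = x ^ 2 + 2 * x * y * γ + y ^ 2 := by
      rw [norm_add_sq_real, norm_smul, norm_smul, hp, hq, inner_smul_left, inner_smul_right, ← hγ]
      simp only [conj_trivial, mul_one, Real.norm_eq_abs, sq_abs]
      ring
    rw [norm_smul, mul_pow, h4, Real.norm_eq_abs, sq_abs, mul_comm]
    gcongr

/-! ### Exponents of caps, pairs of caps and the target region -/

namespace SparseRegime

variable {ℓ : ℕ → ℝ}

/-- The assumption `a² + b² > 1` makes the exponent exceed `1`, so a low vertex expects fewer than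
one high neighbor, by a power of `n`. A quarter of the excess survives the loss caused by `θ`. -/
theorem eventually_two_caps_le (hℓ : SparseRegime ℓ) (a b θ : ℝ) (ha : 0 < a) (hb : 0 < b)
    (hab : 1 < a ^ 2 + b ^ 2) (hθ : 0 ≤ θ) (habθ : 2 * a * b * θ ≤ (a ^ 2 + b ^ 2 - 1) / 2) :
    ∀ᶠ d : ℕ in atTop, ∀ v q : UnitSphere d, ip v q ≤ θ →
      uniformSphere d {u | a * dotScale ℓ d ≤ ip u v ∧ b * dotScale ℓ d ≤ ip u q} ≤
        ENNReal.ofReal (Real.exp (-((1 + (a ^ 2 + b ^ 2 - 1) / 4) * ℓ d))) := by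
  have hk : 0 < a ^ 2 + b ^ 2 := by positivity
  filter_upwards [hℓ.eventually_dotScale_pos, hℓ.eventually_dotScale_le
    (κ := Real.sqrt (1 / (2 * (a ^ 2 + b ^ 2)))) (by positivity), eventually_ge_atTop 1]
    with d hs0 hs hd v q hvq
  have hs2 : dotScale ℓ d ^ 2 ≤ 1 / (2 * (a ^ 2 + b ^ 2)) := by
    rw [← Real.sq_sqrt (by positivity : 0 ≤ 1 / (2 * (a ^ 2 + b ^ 2)))]
    exact pow_le_pow_left₀ hs0.le hs 2
  have hds := hℓ.dim_mul_dotScale_sq (by omega : 0 < d)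
  have hl := hℓ.nonneg d
  generalize dotScale ℓ d = s at *
  have hAB : (a * s) ^ 2 + (b * s) ^ 2 ≤ 1 / 2 := by
    rw [le_div_iff₀ (by positivity)] at hs2
    linarith
  refine (uniformSphere_two_caps_le hd v q (by simp) (by simp) (a * s) (b * s) θ (by positivity)
    (by positivity) hθ hvq hAB).trans (ENNReal.ofReal_le_ofReal (Real.exp_le_exp.2 ?_))
  have h1 : (d : ℝ) * (((a * s) ^ 2 + (b * s) ^ 2) ^ 2 /
      ((a * s) ^ 2 + (b * s) ^ 2 + 2 * (a * s) * (b * s) * θ)) / 2 =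
      (a ^ 2 + b ^ 2) ^ 2 / (a ^ 2 + b ^ 2 + 2 * a * b * θ) * ℓ d := by
    have h2 : (a * s) ^ 2 + (b * s) ^ 2 = (a ^ 2 + b ^ 2) * s ^ 2 := by ring
    have h3 : (a ^ 2 + b ^ 2) * s ^ 2 + 2 * (a * s) * (b * s) * θ =
        (a ^ 2 + b ^ 2 + 2 * a * b * θ) * s ^ 2 := by ring
    have h4 : 0 < a ^ 2 + b ^ 2 + 2 * a * b * θ := by positivity
    have h5 : ℓ d = d * s ^ 2 / 2 := by linarith
    rw [h2, h3, h5]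
    field_simp
  rw [h1]
  have h6 : 1 + (a ^ 2 + b ^ 2 - 1) / 4 ≤
      (a ^ 2 + b ^ 2) ^ 2 / (a ^ 2 + b ^ 2 + 2 * a * b * θ) := by
    rw [le_div_iff₀ (by positivity)]
    nlinarith
  linarith [mul_le_mul_of_nonneg_right h6 hl]

/-- The bound `hE` keeps the short vector within `‖u‖ ≤ 2 s`, since `1 + 3η ≤ 4`. -/
theorem eventually_target_ge (hℓ : SparseRegime ℓ) (a b g η τ : ℝ) (ha : 0 < a) (hb : 0 < b)
    (hab : a ^ 2 + b ^ 2 = 1) (hg : 0 ≤ g) (hg1 : g < 1) (hba : b ≤ a) (hη : 0 ≤ η) (hη1 : η ≤ 1)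
    (hτ : 0 < τ) (hE : (1 - 2 * g * (a * b)) / (1 - g ^ 2) ≤ 1) :
    ∀ᶠ d : ℕ in atTop, ∀ p q : UnitSphere d, g ≤ ip p q →
      Real.exp (-(((1 - 2 * g * (a * b)) / (1 - g ^ 2) + 3 * η + τ) * ℓ d)) ≤
        (uniformSphere d).real
          (targetRegion (a * dotScale ℓ d) ((b + η) * dotScale ℓ d) p q) := by
  filter_upwards [hℓ.eventually_quadrant_ge hτ, eventually_ge_atTop 1] with d h hd p q hpq
  have := isProbabilityMeasure_uniformSphere hd
  have hs0 : 0 ≤ dotScale ℓ d := Real.sqrt_nonneg _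
  obtain ⟨u, hup, huq, hu⟩ := exists_short_vector (p : EuclideanSpace ℝ (Fin d)) q (by simp)
    (by simp) a b g η (dotScale ℓ d) ha hb hab hg hg1 hpq hba hη hη1 hs0
  have hu2 : ‖u‖ ≤ 2 * dotScale ℓ d := by
    refine abs_le_of_sq_le_sq' ?_ (by positivity) |>.2
    refine hu.trans ?_
    rw [mul_pow]
    gcongr
    linarith
  have h1 := h p q u (hg.trans hpq) (le_trans (by positivity) hup) (le_trans (by positivity) huq) hu2
  refine le_trans (Real.exp_le_exp.2 ?_) (h1.trans (measureReal_mono ?_))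
  · have hds := hℓ.dim_mul_dotScale_sq (by omega : 0 < d)
    have h2 := mul_le_mul_of_nonneg_left hu (Nat.cast_nonneg (α := ℝ) d)
    have h3 : (d : ℝ) * (((1 - 2 * g * (a * b)) / (1 - g ^ 2) + 3 * η) * dotScale ℓ d ^ 2) =
        2 * (((1 - 2 * g * (a * b)) / (1 - g ^ 2) + 3 * η) * ℓ d) := by
      linear_combination ((1 - 2 * g * (a * b)) / (1 - g ^ 2) + 3 * η) * hds
    linarith
  · rintro x ⟨hx1, hx2⟩
    exact ⟨huq.trans hx2, hup.trans hx1⟩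

theorem eventually_cap_ge (hℓ : SparseRegime ℓ) (a τ : ℝ) (ha : 0 < a) (ha1 : a ≤ 1)
    (hτ : 0 < τ) :
    ∀ᶠ d : ℕ in atTop, ∀ v : UnitSphere d,
      Real.exp (-((a ^ 2 + τ) * ℓ d)) ≤ (uniformSphere d).real {u | a * dotScale ℓ d ≤ ip v u} := by
  filter_upwards [hℓ.eventually_quadrant_ge hτ, eventually_ge_atTop 1] with d h hd v
  have := isProbabilityMeasure_uniformSphere hd
  have hs0 : 0 ≤ dotScale ℓ d := Real.sqrt_nonneg _
  have hvv : inner ℝ (v : EuclideanSpace ℝ (Fin d)) (v : EuclideanSpace ℝ (Fin d)) = (1 : ℝ) := by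
    rw [real_inner_self_eq_norm_sq]; simp
  have hin : inner ℝ ((a * dotScale ℓ d) • (v : EuclideanSpace ℝ (Fin d)))
      (v : EuclideanSpace ℝ (Fin d)) = a * dotScale ℓ d := by
    rw [inner_smul_left, hvv]; simp
  have hn : ‖(a * dotScale ℓ d) • (v : EuclideanSpace ℝ (Fin d))‖ = a * dotScale ℓ d := by
    rw [norm_smul, Real.norm_of_nonneg (by positivity)]; simp
  have h1 := h v v ((a * dotScale ℓ d) • (v : EuclideanSpace ℝ (Fin d)))
    (by rw [ip, hvv]; exact zero_le_one) (by rw [hin]; positivity) (by rw [hin]; positivity)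
    (by rw [hn]; nlinarith)
  rw [hin, hn] at h1
  refine le_trans (Real.exp_le_exp.2 (le_of_eq ?_)) (h1.trans (measureReal_mono ?_))
  · linear_combination (a ^ 2 / 2) * hℓ.dim_mul_dotScale_sq (by omega : 0 < d)
  · rintro x ⟨hx1, _⟩
    rw [Set.mem_ofPred_eq, ip_comm]
    exact hx1

end SparseRegime

/-! ### From many good starting points to space and time bounds -/

theorem natLog_two_le (n : ℕ) (l : ℝ) (hl : 0 ≤ l) (hn : (n : ℝ) = Real.exp l) :
    (Nat.log 2 n : ℝ) ≤ 2 * l := by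
  have hn0 : n ≠ 0 := by
    rintro rfl
    have := Real.exp_pos l
    simp at hn; linarith
  have h1 : ((2 ^ Nat.log 2 n : ℕ) : ℝ) ≤ n := by exact_mod_cast Nat.pow_log_le_self 2 hn0
  push_cast at h1
  rw [hn, ← Real.log_le_iff_le_exp (by positivity), Real.log_pow] at h1
  have h2 := Real.log_two_gt_d9
  have h3 : (0 : ℝ) ≤ (Nat.log 2 n : ℝ) := Nat.cast_nonneg _
  nlinarith

theorem space_le_of_bucket_le {d n : ℕ} (α : ℝ) (x : Fin n → UnitSphere d) (Δ : ℕ)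
    (h : ∀ v, (bucket α x v).length ≤ Δ) :
    space α x ≤ n * d + n * (Δ * (Nat.log 2 n + 1)) := by
  unfold space
  gcongr
  calc _ ≤ ∑ _v : Fin n, Δ * (Nat.log 2 n + 1) :=
        Finset.sum_le_sum fun v _ => Nat.mul_le_mul_right _ (h v)
    _ = _ := by simp

theorem time_bound_le (D Δ d : ℕ) (X k : ℝ) (hX : 1 ≤ X) (hk : 1 ≤ k) (hd : 1 ≤ d)
    (hD : (D : ℝ) ≤ 2 * X) (hΔ : (Δ : ℝ) ≤ 2 * k) :
    ((1 + (D * (2 * d + 1) + 2) * (2 * d + 4 + Δ * (2 * d + 5)) + (2 * d + 1) : ℕ) : ℝ) ≤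
      164 * (X * k * (d * d)) := by
  have hd1 : (1 : ℝ) ≤ d := by exact_mod_cast hd
  push_cast
  have h1 : (D : ℝ) * (2 * d + 1) + 2 ≤ 8 * (X * d) := by
    have : 1 ≤ X * d := one_le_mul_of_one_le_of_one_le hX hd1
    calc (D : ℝ) * (2 * d + 1) + 2 ≤ 2 * X * (3 * d) + 2 := by gcongr; linarith
      _ ≤ _ := by linarith
  have h2 : 2 * (d : ℝ) + 4 + Δ * (2 * d + 5) ≤ 20 * (k * d) := by
    have : (d : ℝ) ≤ k * d := le_mul_of_one_le_left (by positivity) hk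
    calc 2 * (d : ℝ) + 4 + Δ * (2 * d + 5) ≤ 6 * d + 2 * k * (7 * d) := by gcongr <;> linarith
      _ ≤ _ := by linarith
  have h3 : ((D : ℝ) * (2 * d + 1) + 2) * (2 * d + 4 + Δ * (2 * d + 5)) ≤
      8 * (X * d) * (20 * (k * d)) := by gcongr
  have h4 : (d : ℝ) ≤ X * k * (d * d) := by
    have h5 : 1 ≤ X * k * d :=
      one_le_mul_of_one_le_of_one_le (one_le_mul_of_one_le_of_one_le hX hk) hd1
    calc (d : ℝ) ≤ X * k * d * d := le_mul_of_one_le_left (by positivity) h5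
      _ = _ := by ring
  linarith

open Classical in
-- With `n^x` draws and buckets of size `n^κ`, the constants, the factors `d` and the logarithm are
-- absorbed by three factors `n^τ`.
theorem success_ge {d n : ℕ} (hd : 1 ≤ d) (i : Fin n) (pstar q : UnitSphere d)
    (α γ r β l x κ τ : ℝ) (A : Fin n → Set (Fin n → UnitSphere d))
    (hA : ∀ v, MeasurableSet (A v)) (B : Set (Fin n → UnitSphere d))
    (hB : dataLaw d n i pstar B ≤ ENNReal.ofReal β) (hβ : 0 ≤ β)
    (hl : 0 ≤ l) (hn : (n : ℝ) = Real.exp l) (hx : 0 ≤ x) (hκ : 0 ≤ κ)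
    (hdτ : (d : ℝ) ≤ Real.exp (τ * l)) (hcτ : 164 ≤ Real.exp (τ * l))
    (hlτ : 4 * l + 2 ≤ Real.exp (τ * l))
    (hi : ∀ y ∉ B, γ ≤ ip (y i) q) (hother : ∀ y ∉ B, ∀ j, j ≠ i → ip (y j) q + 1 / (d : ℝ) ≤ γ)
    (hΔ : ∀ y ∉ B, ∀ v, ((bucket α y v).length : ℝ) ≤ 1 + Real.exp (κ * l))
    (hgood : ∀ y ∉ B, ∀ v, y ∈ A v → IsGoodStart α y q i v)
    (hcard : ∀ y ∉ B, r * n ≤ ((Finset.univ.filter fun v => y ∈ A v).card : ℝ)) :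
    1 - (β + Real.exp (-(r * ⌈Real.exp (x * l)⌉₊))) ≤
      ((dataLaw d n i pstar).prod (coinLaw n)).real
      {s | (space α s.1 : ℝ) ≤ (n : ℝ) ^ (1 + κ + 3 * τ) ∧
        ∃ T : ℕ, QueryReturns α γ s.1 q s.2 i T ∧ (T : ℝ) ≤ (n : ℝ) ^ (x + κ + 3 * τ)} := by
  have : Nonempty (Fin n) := ⟨i⟩
  have := isProbabilityMeasure_dataLaw hd i pstar
  have := isProbabilityMeasure_coinLaw n
  have hX1 : 1 ≤ Real.exp (x * l) := Real.one_le_exp (by positivity)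
  have hk1 : 1 ≤ Real.exp (κ * l) := Real.one_le_exp (by positivity)
  have hd0 : (1 : ℝ) ≤ d := by exact_mod_cast hd
  refine (prod_walk_failure_le hd i pstar q α γ r β ⌊1 + Real.exp (κ * l)⌋₊ ⌈Real.exp (x * l)⌉₊
    A hA B hB hβ hi hother (fun y hy v => Nat.le_floor (hΔ y hy v)) hgood hcard).trans
    (measureReal_mono ?_)
  rintro s ⟨hs, T, hT, hTle⟩
  have hΔ2 : (⌊1 + Real.exp (κ * l)⌋₊ : ℝ) ≤ 2 * Real.exp (κ * l) :=
    (Nat.floor_le (by positivity)).trans (by linarith)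
  have hD2 : (⌈Real.exp (x * l)⌉₊ : ℝ) ≤ 2 * Real.exp (x * l) :=
    (Nat.ceil_lt_add_one (by positivity)).le.trans (by linarith)
  refine ⟨?_, T, hT, ?_⟩
  · have h1 : (space α s.1 : ℝ) ≤ _ := Nat.cast_le.2 (space_le_of_bucket_le α s.1 _ hs)
    refine h1.trans ?_
    push_cast
    have h2 := natLog_two_le n l hl hn
    calc (n : ℝ) * d + n * (⌊1 + Real.exp (κ * l)⌋₊ * (Nat.log 2 n + 1))
        ≤ n * Real.exp (τ * l) + n * (2 * Real.exp (κ * l) * (2 * l + 1)) := by gcongr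
      _ = n * (Real.exp (τ * l) + Real.exp (κ * l) * (4 * l + 2)) := by ring
      _ ≤ n * (Real.exp (κ * l) * Real.exp (τ * l) + Real.exp (κ * l) * Real.exp (τ * l)) := by
        gcongr
        exact le_mul_of_one_le_left (Real.exp_pos _).le hk1
      _ = n * Real.exp (κ * l) * Real.exp (τ * l) * 2 * 1 := by ring
      _ ≤ n * Real.exp (κ * l) * Real.exp (τ * l) * Real.exp (τ * l) * Real.exp (τ * l) := by
        gcongr
        · linarith
        · linarith
      _ = (n : ℝ) ^ (1 + κ + 3 * τ) := by
        rw [hn, ← Real.exp_mul, ← Real.exp_add, ← Real.exp_add, ← Real.exp_add, ← Real.exp_add]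
        congr 1; ring
  · have h1 : (T : ℝ) ≤ _ := Nat.cast_le.2 hTle
    refine h1.trans ((time_bound_le _ _ d _ _ hX1 hk1 hd hD2 hΔ2).trans ?_)
    calc _ ≤ Real.exp (τ * l) * (Real.exp (x * l) * Real.exp (κ * l) *
          (Real.exp (τ * l) * Real.exp (τ * l))) := by gcongr
      _ = (n : ℝ) ^ (x + κ + 3 * τ) := by
        rw [hn, ← Real.exp_mul, ← Real.exp_add, ← Real.exp_add, ← Real.exp_add, ← Real.exp_add]
        congr 1; ring

/-- The `α`-near neighbor graphs solve the planted problem with space exponent `1 + σ` and query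
time exponent `ρ`. -/
def Achieves (γ ρ σ : ℝ) (n : ℕ → ℕ) (α : ℕ → ℝ) : Prop :=
  ∀ ε > (0 : ℝ), ∀ δ > (0 : ℝ), ∀ᶠ d : ℕ in atTop,
    ∀ (q pstar : UnitSphere d) (i : Fin (n d)), γ ≤ ip pstar q →
      1 - δ ≤ ((dataLaw d (n d) i pstar).prod (coinLaw (n d))).real
        {s : (Fin (n d) → UnitSphere d) × (ℕ → Fin (n d)) |
          (space (α d) s.1 : ℝ) ≤ (n d : ℝ) ^ (1 + σ + ε) ∧
          ∃ T : ℕ, QueryReturns (α d) γ s.1 q s.2 i T ∧ (T : ℝ) ≤ (n d : ℝ) ^ (ρ + ε)}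

theorem probability_success_mono {d n : ℕ} (hd : 1 ≤ d) (i : Fin n) (pstar q : UnitSphere d)
    (α γ : ℝ) {a b a' b' : ℝ} (ha : a ≤ a') (hb : b ≤ b') :
    ((dataLaw d n i pstar).prod (coinLaw n)).real
      {s | (space α s.1 : ℝ) ≤ (n : ℝ) ^ a ∧
        ∃ T : ℕ, QueryReturns α γ s.1 q s.2 i T ∧ (T : ℝ) ≤ (n : ℝ) ^ b} ≤
    ((dataLaw d n i pstar).prod (coinLaw n)).real
      {s | (space α s.1 : ℝ) ≤ (n : ℝ) ^ a' ∧
        ∃ T : ℕ, QueryReturns α γ s.1 q s.2 i T ∧ (T : ℝ) ≤ (n : ℝ) ^ b'} := by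
  have : Nonempty (Fin n) := ⟨i⟩
  have := isProbabilityMeasure_dataLaw hd i pstar
  have := isProbabilityMeasure_coinLaw n
  have hn : (1 : ℝ) ≤ n := by exact_mod_cast Fin.pos_iff_nonempty.2 ⟨i⟩
  refine measureReal_mono ?_
  rintro s ⟨h1, T, hT, h2⟩
  exact ⟨h1.trans (Real.rpow_le_rpow_of_exponent_le hn ha), T, hT,
    h2.trans (Real.rpow_le_rpow_of_exponent_le hn hb)⟩

theorem Achieves.mono {γ ρ σ ρ' σ' : ℝ} {n : ℕ → ℕ} {α : ℕ → ℝ} (h : Achieves γ ρ σ n α)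
    (hρ : ρ ≤ ρ') (hσ : σ ≤ σ') : Achieves γ ρ' σ' n α := by
  intro ε hε δ hδ
  filter_upwards [h ε hε δ hδ, eventually_ge_atTop 1] with d hd h1 q pstar i hip
  exact (hd q pstar i hip).trans
    (probability_success_mono h1 i pstar q (α d) γ (by linarith) (by linarith))

/-! ### The two regimes: uniform sampling and the greedy walk -/

theorem exp_log_card {n : ℕ} (i : Fin n) : (n : ℝ) = Real.exp (Real.log n) := by
  rw [Real.exp_log]
  exact_mod_cast Fin.pos_iff_nonempty.2 ⟨i⟩

theorem mul_exp_neg_le_of_le {l x y : ℝ} (h : l + y ≤ x) :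
    Real.exp l * Real.exp (-x) ≤ Real.exp (-y) := by
  rw [← Real.exp_add]
  exact Real.exp_le_exp.2 (by linarith)

/-- With an essentially empty graph, the walk amounts to uniform sampling. -/
theorem achieves_sampling (γ : ℝ) (hγ : 0 < γ) (hγ1 : γ < 1) (n : ℕ → ℕ)
    (hℓ : SparseRegime fun d => Real.log (n d)) : Achieves γ 1 0 n fun _ => 1 / 2 := by
  classical
  intro ε hε δ hδ
  set τ := ε / 8 with hτdef
  have hτ : 0 < τ := by positivity
  filter_upwards [eventually_ge_atTop 1, hℓ.eventually_le_dim (κ := (γ / 2) ^ 2 / 4) (by positivity),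
    hℓ.eventually_le_dim (κ := 1 / 8) (by norm_num), hℓ.eventually_dim_le hτ,
    hℓ.eventually_le_exp hτ 0 164, hℓ.eventually_le_exp hτ 4 2,
    hℓ.eventually_le_exp one_pos 0 (3 / δ), tendsto_one_div_atTop_nhds_zero_nat.eventually_le_const
      (by positivity : (0 : ℝ) < γ / 2)]
    with d hd hfar hcap hdτ hcτ hlτ hδ' hdγ q pstar i hip
  have hl := hℓ.nonneg d
  have hn := exp_log_card i
  simp only [zero_mul, zero_add, one_mul] at hcτ hδ'
  generalize Real.log (n d) = l at *
  have hd0 : (1 : ℝ) ≤ d := by exact_mod_cast hd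
  set N1 := Real.exp (-(d * (1 / 2 : ℝ) ^ 2 / 2))
  have hnN1 : n d * N1 ≤ 1 := by
    rw [hn, ← Real.exp_zero, ← neg_zero]
    exact mul_exp_neg_le_of_le (by linarith)
  have b1 : n d * Real.exp (-(d * (γ / 2) ^ 2 / 2)) ≤ Real.exp (-l) := by
    rw [hn]
    exact mul_exp_neg_le_of_le (by linarith)
  have b2 : n d * Real.exp (2 * (n d * N1) - Real.exp (τ * l)) ≤ Real.exp (-l) := by
    calc n d * Real.exp (2 * (n d * N1) - Real.exp (τ * l)) ≤
          Real.exp l * Real.exp (-(Real.exp (τ * l) - 2)) := by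
          rw [← hn]; gcongr; linarith
      _ ≤ _ := mul_exp_neg_le_of_le (by linarith)
  have b3 : Real.exp (-(1 / (n d : ℝ) * ⌈Real.exp ((1 + τ) * l)⌉₊)) ≤ Real.exp (-l) := by
    apply Real.exp_le_exp.2
    have h1 : Real.exp (τ * l) ≤ 1 / (n d : ℝ) * ⌈Real.exp ((1 + τ) * l)⌉₊ := by
      calc Real.exp (τ * l) = 1 / (n d : ℝ) * Real.exp ((1 + τ) * l) := by
            rw [hn, one_div, ← Real.exp_neg, ← Real.exp_add]; congr 1; ring
        _ ≤ _ := by gcongr; exact Nat.le_ceil _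
    linarith
  have b4 : 3 * Real.exp (-l) ≤ δ := by
    rw [Real.exp_neg, ← div_eq_mul_inv, div_le_iff₀ (Real.exp_pos _)]
    rw [div_le_iff₀ hδ] at hδ'
    linarith
  have m0 := dataLaw_ne_pstar i pstar hd
  have m1 := dataLaw_exists_far_le hd i pstar q (γ / 2) (by positivity) (by nlinarith)
  have m2 := dataLaw_exists_bucket_gt_le hd i pstar (1 / 2) (by norm_num) (by norm_num)
    (Real.exp (τ * l))
  have key := success_ge hd i pstar q (1 / 2) γ (1 / (n d : ℝ))
    (n d * Real.exp (-(d * (γ / 2) ^ 2 / 2)) +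
      n d * Real.exp (2 * (n d * N1) - Real.exp (τ * l))) l (1 + τ) τ τ
    -- Only `i` itself is counted as a good start, a fraction `1 / n`, so `n^(1+τ)` draws suffice.
    (fun v => if v = i then Set.univ else ∅) (fun v => by
      by_cases h : v = i
      · simp [h]
      · simp [h])
    ({x | x i ≠ pstar} ∪ ({x | ∃ j, j ≠ i ∧ γ / 2 < ip (x j) q} ∪
      {x | ∃ v, 1 + Real.exp (τ * l) < (bucket (1 / 2) x v).length})) (by
      refine (measure_union_le _ _).trans ?_
      rw [m0, zero_add, ENNReal.ofReal_add (by positivity) (by positivity)]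
      exact (measure_union_le _ _).trans (add_le_add m1 m2)) (by positivity) hl hn (by positivity)
    hτ.le hdτ hcτ hlτ (fun y hy => by
      simp only [Set.mem_union, Set.mem_ofPred_eq, not_or, ne_eq, not_not] at hy
      rw [hy.1]; exact hip) (fun y hy j hj => by
      simp only [Set.mem_union, Set.mem_ofPred_eq, not_or, not_exists, not_and, not_lt] at hy
      linarith [hy.2.1 j hj]) (fun y hy v => by
      simp only [Set.mem_union, Set.mem_ofPred_eq, not_or, not_exists, not_and, not_lt] at hy
      exact hy.2.2 v) (fun y hy v hv => by
      by_cases h : v = i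
      · exact Or.inl h
      · simp [h] at hv) (fun y hy => by
      have hne : (n d : ℝ) ≠ 0 := by rw [hn]; exact (Real.exp_pos _).ne'
      rw [one_div, inv_mul_cancel₀ hne, Nat.one_le_cast, Nat.one_le_iff_ne_zero, Finset.card_ne_zero]
      exact ⟨i, by simp⟩)
  refine le_trans ?_ (key.trans
    (probability_success_mono hd i pstar q (1 / 2) γ (by linarith) (by linarith)))
  linarith

/-- Here `n^(-F)` bounds the target probability from below. Far points, bucket sizes, the number of
targets, degrees and missed draws each fail with probability at most `1/n`; the two bad classes of
edges contribute `64 n^(-τ)` each. The total is at most `133 n^(-τ) ≤ δ`. -/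
theorem greedy_success_ge {d n : ℕ} (hd : 1 ≤ d) (i : Fin n) (pstar q : UnitSphere d)
    (γ σ a h t θ ξ τ F l δ s : ℝ) (ha2 : a ^ 2 = 1 - σ) (hσ : 0 < σ) (hα : 0 ≤ a * s)
    (hα2 : (a * s) ^ 2 ≤ 1 / 2) (hds : d * s ^ 2 = 2 * l) (hθ0 : 0 ≤ θ) (hθ1 : θ ^ 2 ≤ 1 / 2)
    (hθγ : θ ≤ γ / 2) (hdγ : 1 / (d : ℝ) ≤ γ / 2) (hht : h + 1 / (d : ℝ) ≤ t) (hτ0 : 0 < τ)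
    (hτ1 : τ ≤ 1) (hτξ : τ ≤ ξ / 2) (hσF : σ ≤ F) (hn : (n : ℝ) = Real.exp l) (hn4 : 4 ≤ n)
    (hl : 0 ≤ l) (hδ : 0 < δ) (hfar : l ≤ θ ^ 2 / 4 * d) (hdτ : (d : ℝ) ≤ Real.exp (τ * l))
    (hcτ : 164 ≤ Real.exp (τ * l)) (hlτ : 4 * l + 2 ≤ Real.exp (τ * l))
    (hlF : 16 * l ≤ Real.exp ((1 - F) * l)) (hlσ : 32 * l ≤ Real.exp ((σ - τ) * l))
    (hlτ32 : 32 * l ≤ Real.exp (τ * l)) (hδ' : 133 / δ ≤ Real.exp (τ * l))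
    (hcaps : ∀ v : UnitSphere d, ip v q ≤ θ →
      uniformSphere d {u | a * s ≤ ip u v ∧ h ≤ ip u q} ≤
        ENNReal.ofReal (Real.exp (-((1 + ξ) * l))))
    (hT : Real.exp (-(F * l)) ≤ (uniformSphere d).real (targetRegion (a * s) t pstar q))
    (hcap : ∀ v : UnitSphere d,
      Real.exp (-((a ^ 2 + τ) * l)) ≤ (uniformSphere d).real {u | a * s ≤ ip v u})
    (hip : γ ≤ ip pstar q) :
    1 - δ ≤ ((dataLaw d n i pstar).prod (coinLaw n)).real
      {s' | (space (a * s) s'.1 : ℝ) ≤ (n : ℝ) ^ (1 + (σ + τ) + 3 * τ) ∧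
        ∃ T : ℕ, QueryReturns (a * s) γ s'.1 q s'.2 i T ∧
          (T : ℝ) ≤ (n : ℝ) ^ (F - σ + 2 * τ + (σ + τ) + 3 * τ)} := by
  classical
  obtain ⟨pT, hpT⟩ : ∃ p, p = (uniformSphere d).real (targetRegion (a * s) t pstar q) := ⟨_, rfl⟩
  rw [← hpT] at hT
  have hpT0 : 0 < pT := (Real.exp_pos _).trans_le hT
  have hN1 : Real.exp (-(d * (a * s) ^ 2 / 2)) = Real.exp (-((1 - σ) * l)) := by
    congr 1
    rw [← ha2]
    linear_combination (-a ^ 2 / 2) * hds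
  have hdinv : 0 ≤ 1 / (d : ℝ) := by positivity
  obtain ⟨B, hB, hBgood⟩ := exists_rare_set_relay hd hn4 i pstar q (a * s) h t θ
    (Real.exp ((σ + τ) * l)) (Real.exp (-((a ^ 2 + τ) * l))) (Real.exp (-((1 + ξ) * l))) hα hα2
    hθ0 hθ1 (by linarith) (Real.exp_pos _) (Real.exp_pos _).le (hpT ▸ hpT0) hcap hcaps
  rw [hN1, ← hpT] at hB
  have hX : 1 ≤ Real.exp (σ * l) := Real.one_le_exp (by positivity)
  have b1 : n * Real.exp (-(d * θ ^ 2 / 2)) ≤ Real.exp (-l) := by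
    rw [hn]
    exact mul_exp_neg_le_of_le (by linarith)
  have b2 : n * Real.exp (2 * (n * Real.exp (-((1 - σ) * l))) - Real.exp ((σ + τ) * l)) ≤
      Real.exp (-l) := by
    have h1 : n * Real.exp (-((1 - σ) * l)) = Real.exp (σ * l) := by
      rw [hn, ← Real.exp_add]; congr 1; ring
    have h2 : Real.exp ((σ + τ) * l) = Real.exp (σ * l) * Real.exp (τ * l) := by
      rw [← Real.exp_add]; congr 1; ring
    rw [h1, h2, hn, ← Real.exp_add]
    apply Real.exp_le_exp.2
    have h3 := mul_le_mul_of_nonneg_left (by linarith : 2 * l + 2 ≤ Real.exp (τ * l))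
      (Real.exp_pos (σ * l)).le
    have h4 := mul_le_mul_of_nonneg_right hX hl
    linarith
  have b3 : Real.exp (-(n * pT / 16)) ≤ Real.exp (-l) := by
    apply Real.exp_le_exp.2
    have h1 : Real.exp ((1 - F) * l) ≤ n * pT := by
      calc Real.exp ((1 - F) * l) = Real.exp l * Real.exp (-(F * l)) := by
            rw [← Real.exp_add]; congr 1; ring
        _ ≤ _ := by rw [hn]; gcongr
    linarith
  have b4 : n * Real.exp (-(n * Real.exp (-((a ^ 2 + τ) * l)) / 16)) ≤ Real.exp (-l) := by
    have h1 : n * Real.exp (-((a ^ 2 + τ) * l)) = Real.exp ((σ - τ) * l) := by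
      rw [hn, ← Real.exp_add, ha2]; congr 1; ring
    rw [h1, hn]
    exact mul_exp_neg_le_of_le (by linarith)
  have hξl := mul_le_mul_of_nonneg_right hτξ hl
  have hσl := mul_nonneg hσ.le hl
  have b5 : 64 * Real.exp (-((1 + ξ) * l)) / Real.exp (-((a ^ 2 + τ) * l)) ≤
      64 * Real.exp (-(τ * l)) := by
    rw [mul_div_assoc, ← Real.exp_sub, ha2]
    gcongr
    linarith
  have b6 : 64 * (n * Real.exp (-((1 + ξ) * l)) * Real.exp (-((1 - σ) * l))) /
      Real.exp (-((a ^ 2 + τ) * l)) ≤ 64 * Real.exp (-(τ * l)) := by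
    rw [mul_div_assoc, hn, ← Real.exp_add, ← Real.exp_add, ← Real.exp_sub, ha2]
    gcongr
    linarith
  -- `r` is the fraction of relay starts, `n² · n^(-F) · n^(-(1-σ+τ)) / 32` divided by `n`; `D`
  -- exceeds `1 / r` by a factor of order `n^τ`.
  set r := Real.exp ((σ - F - τ) * l) / 32 with hr
  set D := ⌈Real.exp ((F - σ + 2 * τ) * l)⌉₊ with hD
  have b7 : Real.exp (-(r * D)) ≤ Real.exp (-l) := by
    apply Real.exp_le_exp.2
    have h1 : Real.exp (τ * l) / 32 ≤ r * D := by
      calc Real.exp (τ * l) / 32 = r * Real.exp ((F - σ + 2 * τ) * l) := by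
            rw [hr, div_mul_eq_mul_div, ← Real.exp_add]; congr 2; ring
        _ ≤ _ := by gcongr; exact Nat.le_ceil _
    linarith
  have b8 : 133 * Real.exp (-(τ * l)) ≤ δ := by
    rw [Real.exp_neg, ← div_eq_mul_inv, div_le_iff₀ (Real.exp_pos _)]
    rw [div_le_iff₀ hδ] at hδ'
    linarith
  have b9 : Real.exp (-l) ≤ Real.exp (-(τ * l)) := Real.exp_le_exp.2 (by linarith [mul_le_mul_of_nonneg_right hτ1 hl])
  have key := success_ge hd i pstar q (a * s) γ r _ l (F - σ + 2 * τ) (σ + τ) τ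
    (fun v => relaySet (a * s) h t i pstar q v)
    (measurableSet_relaySet _ _ _ _ _ _) B hB (by positivity) hl hn
    (by linarith) (by linarith) hdτ hcτ hlτ
    (fun y hy => by rw [(hBgood y hy).1]; exact hip)
    (fun y hy j hj => by linarith [(hBgood y hy).2.1 j hj])
    (fun y hy v => (hBgood y hy).2.2.1 v)
    (fun y hy v hv => isGoodStart_of_mem_relaySet (a * s) h t i pstar q y
      (hBgood y hy).1 hht v hv)
    (fun y hy => by
      refine le_trans ?_ (hBgood y hy).2.2.2
      rw [← hpT]
      have h1 : Real.exp (-(F * l)) * Real.exp (-((a ^ 2 + τ) * l)) ≤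
          pT * Real.exp (-((a ^ 2 + τ) * l)) := by gcongr
      have h2 : (n : ℝ) ^ 2 * (Real.exp (-(F * l)) * Real.exp (-((a ^ 2 + τ) * l))) / 32 =
          r * n := by
        rw [hr, hn, ha2, ← Real.exp_nat_mul, div_mul_eq_mul_div, ← Real.exp_add, ← Real.exp_add,
          ← Real.exp_add]
        congr 2; push_cast; ring
      rw [← h2]
      gcongr)
  refine le_trans ?_ key
  linarith

/-- The order of choice matters: `η` is small against `ε` and `1 - E`, which keeps the number of
targets a positive power of `n`; it creates the excess `4ξ` of the two-cap exponent over `1`, and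
`θ`, `τ` are then small against `ξ`. -/
theorem exists_greedy_parameters (a b σ E γ ε : ℝ) (ha0 : 0 < a) (ha1 : a ≤ 1) (hb0 : 0 < b)
    (hb1 : b ≤ 1) (hab : a ^ 2 + b ^ 2 = 1) (hσ : 0 < σ) (hE : E < 1) (hγ : 0 < γ) (hε : 0 < ε) :
    ∃ η θ τ : ℝ, 0 < η ∧ 0 < θ ∧ 0 < τ ∧ η ≤ 1 ∧ 3 * η + 8 * τ ≤ ε ∧ 3 * η + τ < 1 - E ∧
      1 < a ^ 2 + (b + η / 2) ^ 2 ∧ θ ≤ γ / 2 ∧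
      2 * a * (b + η / 2) * θ ≤ (a ^ 2 + (b + η / 2) ^ 2 - 1) / 2 ∧ τ ≤ 1 ∧
      τ ≤ (a ^ 2 + (b + η / 2) ^ 2 - 1) / 4 / 2 ∧ τ ≤ σ / 2 := by
  obtain ⟨η, hη0, hη1, hηε, hηE⟩ : ∃ η > 0, η ≤ 1 ∧ η ≤ ε / 12 ∧ η ≤ (1 - E) / 12 :=
    ⟨min 1 (min (ε / 12) ((1 - E) / 12)), lt_min one_pos (lt_min (by positivity) (by linarith)),
      min_le_left _ _, (min_le_right _ _).trans (min_le_left _ _),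
      (min_le_right _ _).trans (min_le_right _ _)⟩
  have hk : 1 < a ^ 2 + (b + η / 2) ^ 2 := by
    have h1 := mul_pos hb0 hη0
    have h2 := sq_nonneg η
    linarith
  obtain ⟨ξ, hξ⟩ : ∃ ξ, ξ = (a ^ 2 + (b + η / 2) ^ 2 - 1) / 4 := ⟨_, rfl⟩
  have hξ0 : 0 < ξ := by rw [hξ]; linarith
  refine ⟨η, min (γ / 2) (ξ / 2), min 1 (min (ε / 16) (min ((1 - E) / 4) (min (ξ / 2) (σ / 2)))),
    hη0, lt_min (by positivity) (by positivity), lt_min one_pos (lt_min (by positivity)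
      (lt_min (by linarith) (lt_min (by positivity) (by positivity)))), hη1, ?_, ?_, hk,
    min_le_left _ _, ?_, min_le_left _ _, ?_, ?_⟩
  · have : min 1 (min (ε / 16) (min ((1 - E) / 4) (min (ξ / 2) (σ / 2)))) ≤ ε / 16 := by simp
    linarith
  · have : min 1 (min (ε / 16) (min ((1 - E) / 4) (min (ξ / 2) (σ / 2)))) ≤ (1 - E) / 4 := by simp
    linarith
  · have h1 : a * (b + η / 2) ≤ 1 * (3 / 2) := by gcongr; linarith
    have h2 : a * (b + η / 2) * min (γ / 2) (ξ / 2) ≤ 1 * (3 / 2) * (ξ / 2) :=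
      mul_le_mul h1 (min_le_right _ _) (le_min (by positivity) (by positivity)) (by norm_num)
    linarith
  · rw [← hξ]; simp
  · simp

/-- The query time exponent `E` balances the bucket size `n ^ σ` against the probability that the
best point of a bucket is a neighbor of the planted point. -/
theorem achieves_greedy (γ a b σ E : ℝ) (hγ : 0 < γ) (hγ1 : γ < 1) (ha2 : a ^ 2 = 1 - σ)
    (hb2 : b ^ 2 = σ) (hb0 : 0 < b) (hba : b ≤ a)
    (hEdef : E = (1 - 2 * γ * (a * b)) / (1 - γ ^ 2)) (hE : E < 1) (n : ℕ → ℕ)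
    (hℓ : SparseRegime fun d => Real.log (n d)) (α : ℕ → ℝ)
    (hα : ∀ᶠ d in atTop, α d = a * dotScale (fun d => Real.log (n d)) d) :
    Achieves γ E σ n α := by
  intro ε hε δ hδ
  have ha0 : 0 < a := hb0.trans_le hba
  have hσ : 0 < σ := hb2 ▸ pow_pos hb0 2
  have hab : a ^ 2 + b ^ 2 = 1 := by rw [ha2, hb2]; ring
  have ha1 : a ≤ 1 := by nlinarith
  have hb1 : b ≤ 1 := hba.trans ha1
  -- This is `(a - γ b)² ≥ 0`; it makes the exponent `E - σ` of the number of draws nonnegative.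
  have hEσ : σ ≤ E := by
    rw [hEdef, le_div_iff₀ (by nlinarith)]
    have h1 := sq_nonneg (a - γ * b)
    have h2 : (a - γ * b) ^ 2 = a ^ 2 - 2 * γ * (a * b) + γ ^ 2 * b ^ 2 := by ring
    rw [h2, ha2, hb2] at h1
    linarith
  obtain ⟨η, θ, τ, hη0, hθ0, hτ0, hη1, hηε, hηE, hk1, hθγ, hθk, hτ1, hτξ, hτσ⟩ :=
    exists_greedy_parameters a b σ E γ ε ha0 ha1 hb0 hb1 hab hσ hE hγ hε
  have htgt := hℓ.eventually_target_ge a b γ η τ ha0 hb0 hab hγ.le hγ1 hba hη0.le hη1 hτ0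
    (hEdef ▸ hE.le)
  rw [← hEdef] at htgt
  filter_upwards [hα, eventually_ge_atTop 1,
    hℓ.eventually_le_dim (κ := θ ^ 2 / 4) (by positivity),
    hℓ.eventually_dim_le hτ0, hℓ.eventually_le_exp hτ0 0 164, hℓ.eventually_le_exp hτ0 4 2,
    hℓ.eventually_le_exp (by linarith : 0 < 1 - (E + 3 * η + τ)) 16 0,
    hℓ.eventually_le_exp (by linarith : 0 < σ - τ) 32 0, hℓ.eventually_le_exp hτ0 32 0,
    hℓ.eventually_le_exp hτ0 0 (133 / δ), hℓ.eventually_ge 2,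
    tendsto_one_div_atTop_nhds_zero_nat.eventually_le_const (by positivity : (0 : ℝ) < γ / 2),
    hℓ.eventually_two_caps_le a (b + η / 2) θ ha0 (by positivity) hk1 hθ0.le hθk, htgt,
    hℓ.eventually_cap_ge a τ ha0 ha1 hτ0, hℓ.eventually_dotScale_le (κ := 1 / 2) (by norm_num),
    hℓ.eventually_one_div_le (κ := η / 2) (by positivity)]
    with d hαd hd hfar hdτ hcτ hlτ hlF hlσ hlτ32 hδ' hl2 hdγ hcaps htarget hcap hs hsd
      q pstar i hip
  have hds := hℓ.dim_mul_dotScale_sq (by omega : 0 < d)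
  have hn := exp_log_card i
  have hs0 : 0 ≤ dotScale (fun d => Real.log (n d)) d := Real.sqrt_nonneg _
  simp only [zero_mul, zero_add, add_zero] at hcτ hδ' hlF hlσ hlτ32
  rw [hαd]
  have hT := htarget pstar q hip
  have hn4 : 4 ≤ n d := by
    have h1 : (2 : ℝ) ≤ Real.exp 1 := by linarith [Real.add_one_le_exp (1 : ℝ)]
    have h2 : (4 : ℝ) ≤ n d := by
      rw [hn]
      calc (4 : ℝ) = 2 ^ 2 := by norm_num
        _ ≤ Real.exp 1 ^ 2 := by gcongr
        _ = Real.exp 2 := by rw [← Real.exp_nat_mul]; norm_num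
        _ ≤ _ := Real.exp_le_exp.2 hl2
    exact_mod_cast h2
  obtain ⟨s, hsdef⟩ : ∃ s, s = dotScale (fun d => Real.log (n d)) d := ⟨_, rfl⟩
  rw [← hsdef] at hds hs0 hT hcaps hcap hs hsd ⊢
  have hαs : a * s ≤ 1 * (1 / 2) := by gcongr
  have hαs0 : 0 ≤ a * s := by positivity
  have hαs2 : (a * s) ^ 2 ≤ 1 / 2 := (pow_le_pow_left₀ hαs0 hαs 2).trans (by norm_num)
  have hθ2 : θ ^ 2 ≤ 1 / 2 :=
    (pow_le_pow_left₀ hθ0.le (by linarith : θ ≤ 1 / 2) 2).trans (by norm_num)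
  refine (greedy_success_ge hd i pstar q γ σ a ((b + η / 2) * s) ((b + η) * s) θ _ τ
    (E + 3 * η + τ) _ δ s ha2 hσ hαs0 hαs2 hds hθ0.le hθ2 hθγ hdγ (by linarith) hτ0 hτ1 hτξ
    (by linarith) hn hn4 (hℓ.nonneg d) hδ hfar hdτ hcτ hlτ hlF hlσ hlτ32 hδ' (fun v hv => hcaps v q hv) hT
    hcap hip).trans
    (probability_success_mono hd i pstar q (a * s) γ (by linarith) (by linarith))

/-! ### The trade-off condition and the choice of the graph -/

theorem le_ip_of_dist_le {d : ℕ} (c : ℝ) (hc : 0 < c) (q pstar : UnitSphere d)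
    (h : dist pstar q ≤ Real.sqrt 2 / c) : 1 - 1 / c ^ 2 ≤ ip pstar q := by
  rw [Subtype.dist_eq, dist_eq_norm] at h
  have h1 : ‖(pstar : EuclideanSpace ℝ (Fin d)) - q‖ ^ 2 ≤ 2 / c ^ 2 := by
    calc _ ≤ (Real.sqrt 2 / c) ^ 2 := by gcongr
      _ = 2 / c ^ 2 := by rw [div_pow, Real.sq_sqrt (by norm_num)]
  rw [norm_sub_sq_real] at h1
  simp only [norm_eq_of_mem_sphere] at h1
  have h2 : (2 : ℝ) / c ^ 2 = 2 * (1 / c ^ 2) := by ring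
  unfold ip
  linarith

/-- With `γ = 1 - 1/c²` one has `1 - γ² = (2c² - 1)/c⁴`, and clearing denominators gives exactly the
trade-off inequality. -/
theorem greedy_exponent_le (c ρ κ : ℝ) (hc : 1 < c)
    (h : c ^ 4 ≤ (2 * c ^ 2 - 1) * ρ + 2 * c ^ 2 * (c ^ 2 - 1) * κ) :
    (1 - 2 * (1 - 1 / c ^ 2) * κ) / (1 - (1 - 1 / c ^ 2) ^ 2) ≤ ρ := by
  have hc0 : 0 < c := by linarith
  have hc2 : 0 < 2 * c ^ 2 - 1 := by nlinarith
  have h1 : 1 - (1 - 1 / c ^ 2) ^ 2 = (2 * c ^ 2 - 1) / c ^ 4 := by field_simp; ring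
  have h2 : 1 - 2 * (1 - 1 / c ^ 2) * κ = (c ^ 4 - 2 * c ^ 2 * (c ^ 2 - 1) * κ) / c ^ 4 := by
    field_simp
  rw [h1, h2, div_div_div_cancel_right₀ (by positivity), div_le_iff₀ hc2]
  linarith

theorem theorem1 (c ρq ρs : ℝ) (hc : 1 < c) (hρq : 0 ≤ ρq) (hρs : 0 ≤ ρs) (hρs1 : ρs ≤ 1)
    (hρ : c ^ 4 ≤ (2 * c ^ 2 - 1) * ρq + 2 * c ^ 2 * (c ^ 2 - 1) * Real.sqrt (ρs * (1 - ρs)))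
    (n : ℕ → ℕ)
    (hn : (fun d : ℕ => Real.log (n d)) =o[atTop] (fun d : ℕ => (d : ℝ)))
    (hd : (fun d : ℕ => Real.log d) =o[atTop] (fun d : ℕ => Real.log (n d))) :
    ∃ α : ℕ → ℝ, (∀ d, 0 < α d ∧ α d < 1) ∧
      ∀ ε > (0 : ℝ), ∀ δ > (0 : ℝ), ∀ᶠ d : ℕ in atTop,
        ∀ (q pstar : UnitSphere d) (i : Fin (n d)), dist pstar q ≤ Real.sqrt 2 / c →
          1 - δ ≤ ((dataLaw d (n d) i pstar).prod (coinLaw (n d))).real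
            {s : (Fin (n d) → UnitSphere d) × (ℕ → Fin (n d)) |
              (space (α d) s.1 : ℝ) ≤ (n d : ℝ) ^ (1 + ρs + ε) ∧
              ∃ T : ℕ, QueryReturns (α d) (1 - 1 / c ^ 2) s.1 q s.2 i T ∧
                (T : ℝ) ≤ (n d : ℝ) ^ (ρq + ε)} := by
  have hc0 : 0 < c := by linarith
  have hc2 : 1 < c ^ 2 := by nlinarith
  have hγ : 0 < 1 - 1 / c ^ 2 := by
    rw [sub_pos, div_lt_one (by positivity)]; exact hc2
  have hγ1 : 1 - 1 / c ^ 2 < 1 := by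
    have : 0 < 1 / c ^ 2 := by positivity
    linarith
  have hℓ : SparseRegime fun d => Real.log (n d) := ⟨hn, hd, fun d => Real.log_natCast_nonneg _⟩
  suffices h : ∃ α : ℕ → ℝ, (∀ d, 0 < α d ∧ α d < 1) ∧ Achieves (1 - 1 / c ^ 2) ρq ρs n α by
    obtain ⟨α, hα, h⟩ := h
    refine ⟨α, hα, fun ε hε δ hδ => ?_⟩
    filter_upwards [h ε hε δ hδ] with d hd q pstar i hdist
    exact hd q pstar i (le_ip_of_dist_le c hc0 q pstar hdist)
  rcases le_or_gt 1 ρq with h1 | h1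
  · exact ⟨fun _ => 1 / 2, fun _ => by norm_num,
      (achieves_sampling _ hγ hγ1 n hℓ).mono h1 hρs⟩
  -- Since `c⁴ - (2c² - 1) = (c² - 1)² ≥ 0`, an exponent `ρq < 1` needs a positive contribution of
  -- the square root.
  have hκ : 0 < Real.sqrt (ρs * (1 - ρs)) := by
    have h2 : 0 < 2 * c ^ 2 * (c ^ 2 - 1) := by
      have : 0 < c ^ 2 - 1 := by linarith
      positivity
    have h3 : 0 < 2 * c ^ 2 * (c ^ 2 - 1) * Real.sqrt (ρs * (1 - ρs)) := by
      nlinarith [sq_nonneg (c ^ 2 - 1)]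
    exact (mul_pos_iff_of_pos_left h2).1 h3
  have hρs0 : 0 < ρs := by
    rcases hρs.lt_or_eq with h | h
    · exact h
    · rw [← h] at hκ; simp at hκ
  -- `σ (1 - σ)` is largest at `1/2`, so space beyond that is left unused; this also gives `b ≤ a`.
  set σ := min ρs (1 / 2) with hσ
  have hσ0 : 0 < σ := lt_min hρs0 (by norm_num)
  have hσ1 : σ ≤ 1 / 2 := min_le_right _ _
  have hκσ : Real.sqrt (ρs * (1 - ρs)) ≤ Real.sqrt (1 - σ) * Real.sqrt σ := by
    rw [← Real.sqrt_mul (by linarith)]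
    apply Real.sqrt_le_sqrt
    rcases le_total ρs (1 / 2) with h | h
    · rw [hσ, min_eq_left h]; linarith
    · rw [hσ, min_eq_right h]; nlinarith [sq_nonneg (ρs - 1 / 2)]
  have hE := greedy_exponent_le c ρq (Real.sqrt (1 - σ) * Real.sqrt σ) hc (hρ.trans (by
    have : 0 ≤ c ^ 2 - 1 := by linarith
    gcongr))
  have hs1 : Real.sqrt (1 - σ) ≤ 1 := Real.sqrt_le_one.2 (by linarith)
  have hs0 : 0 < Real.sqrt (1 - σ) := Real.sqrt_pos.2 (by linarith)
  set s := dotScale fun d => Real.log (n d)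
  -- The value `1 / 2` only serves the finitely many `d` with `s d` outside `(0, 1)`, since `α d`
  -- must lie in `(0, 1)` for every `d`.
  refine ⟨fun d => if 0 < s d ∧ s d < 1 then Real.sqrt (1 - σ) * s d else 1 / 2, fun d => ?_, ?_⟩
  · show 0 < ite _ _ _ ∧ ite _ _ _ < (1 : ℝ)
    split_ifs with h
    · exact ⟨mul_pos hs0 h.1, by nlinarith [h.1, h.2]⟩
    · norm_num
  · refine (achieves_greedy _ (Real.sqrt (1 - σ)) (Real.sqrt σ) σ _ hγ hγ1
      (Real.sq_sqrt (by linarith)) (Real.sq_sqrt hσ0.le) (Real.sqrt_pos.2 hσ0)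
      (Real.sqrt_le_sqrt (by linarith)) rfl (hE.trans_lt h1) n hℓ _ ?_).mono hE (min_le_left _ _)
    filter_upwards [hℓ.eventually_dotScale_pos, hℓ.eventually_dotScale_le
      (κ := 1 / 2) (by norm_num)] with d h2 h3
    rw [if_pos ⟨h2, lt_of_le_of_lt h3 (by norm_num)⟩]
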